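/- All digraphs are finite and loopless, and directed paths are vertex-simple. A PAFP instance $I=(G,s,t,\mathcal F)$ consists of a digraph $G=(V,E)$, two distinct vertices $s,t\in V$, and a set $\mathcal F\subseteq\binom V2$ of forbidden pairs; it is a YES-instance if $G$ has a directed $s$-$t$ path that contains at most one endpoint of every pair in $\mathcal F$. For a digraph $H$ and a vertex $r$ of $H$, the BFS-width is $\operatorname{bfsw}(H,r)=\max_{d\ge 0}|\{v:\operatorname{dist}_H(r,v)=d\}|$, where $\operatorname{dist}_H$ is the directed shortest-path distance. Write $u\leadsto_G v$ if $u\ne v$ and $G$ has a directed $u$-$v$ path. A strict total order $\prec$ on $V$ is reachability-compatible with $G$ if $u\leadsto_G v$ and $v\not\leadsto_G u$ imply $u\prec v$. Given a rule $G\mapsto\prec_G$ that assigns to every digraph $G$ a reachability-compatible order, the union digraph of an instance is $G\cup\mathcal F=(V,\,E\cup\{(u,v):\{u,v\}\in\mathcal F,\ u\prec_G v\})$. Instances have vertex sets $\{0,\dots,n-1\}$ and are encoded as bit strings by $n,s,t$ in unary and the adjacency matrices of $G$ and of $\mathcal F$. **Theorem.** There is a map $\operatorname{Normalize}$, computable in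 (deterministic Turing machine) polynomial time, that sends every PAFP instance $I=(G,s,t,\mathcal F)$ in which $G$ is a DAG to a PAFP instance $I'=(G',s',t,\mathcal F')$ with the same target $t$ and with a new source $s'\notin V(G)$, such that 1. $G'$ is a DAG; 2. $\operatorname{bfsw}(G'\cup\mathcal F',s')\le 2$, for every choice of the reachability-compatible order rule; 3. $I$ is a YES-instance if and only if $I'$ is a YES-instance. -/

import Mathlib

/-- A directed `u`-`v` path: a list of pairwise distinct vertices, starting at `u` and ending
at `v`, in which consecutive vertices are joined by arcs. Its length is the number of its arcs,
that is, one less than the number of its vertices. -/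
def Digraph.IsDiPath {V : Type} (G : Digraph V) (u v : V) (p : List V) : Prop :=
  p.head? = some u ∧ p.getLast? = some v ∧ p.IsChain G.Adj ∧ p.Nodup

/-- A digraph is acyclic if no vertex lies on a closed directed walk of positive length. -/
def Digraph.IsDAG {V : Type} (G : Digraph V) : Prop :=
  ∀ v : V, ¬ Relation.TransGen G.Adj v v

/-- The length of a shortest directed `u`-`v` path, and `⊤` if there is none. -/
noncomputable def Digraph.diDist {V : Type} (G : Digraph V) (u v : V) : ℕ∞ :=
  ⨅ k ∈ {k : ℕ | ∃ p : List V, G.IsDiPath u v p ∧ p.length = k + 1}, (k : ℕ∞)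

/-- The directed BFS layer at distance `d` from `s`. -/
def Digraph.bfsLayer {V : Type} (G : Digraph V) (s : V) (d : ℕ) : Set V :=
  {v | G.diDist s v = (d : ℕ∞)}

/-- The BFS-width from `s`: the largest cardinality of a directed BFS layer. -/
noncomputable def Digraph.bfsWidth {V : Type} (G : Digraph V) (s : V) : ℕ∞ :=
  ⨆ d : ℕ, (G.bfsLayer s d).encard

/-- Proper reachability: `u ≠ v`, and there is a directed `u`-`v` path. -/
def Digraph.LeadsTo {V : Type} (G : Digraph V) (u v : V) : Prop :=
  u ≠ v ∧ ∃ p : List V, G.IsDiPath u v p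

/-- A strict total order `lt` on the vertices is reachability-compatible with `G` if `u` precedes
`v` whenever `v` is properly reachable from `u` but not conversely. -/
structure Digraph.ReachCompatible {V : Type} (G : Digraph V) (lt : V → V → Prop) : Prop where
  strictTotal : IsStrictTotalOrder V lt
  compat : ∀ u v : V, G.LeadsTo u v → ¬ G.LeadsTo v u → lt u v

/-- A PAFP instance with vertex set `V`: a loopless digraph, two distinct vertices `s` and `t`,
and a set of forbidden pairs, each an unordered pair of distinct vertices. -/
structure PAFP (V : Type) where
  G : Digraph V
  loopless : ∀ v : V, ¬ G.Adj v v
  s : V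
  t : V
  s_ne_t : s ≠ t
  F : Set (Sym2 V)
  F_pairs : ∀ e ∈ F, ¬ e.IsDiag

/-- A path is safe if it contains at most one endpoint of every forbidden pair. -/
def PAFP.IsSafe {V : Type} (I : PAFP V) (p : List V) : Prop :=
  ∀ u v : V, s(u, v) ∈ I.F → ¬ (u ∈ p ∧ v ∈ p)

/-- `I` is a YES-instance if it has a safe directed `s`-`t` path. -/
def PAFP.IsYes {V : Type} (I : PAFP V) : Prop :=
  ∃ p : List V, I.G.IsDiPath I.s I.t p ∧ I.IsSafe p

/-- The union digraph with respect to the vertex order `lt`: every forbidden pair is added as an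
arc that is oriented forward in `lt`. -/
def PAFP.unionDigraph {V : Type} (I : PAFP V) (lt : V → V → Prop) : Digraph V where
  Adj u v := I.G.Adj u v ∨ (s(u, v) ∈ I.F ∧ lt u v)

/-- A rule that assigns to every digraph on a vertex set `{0, …, n - 1}` a reachability-compatible
strict total order on its vertices. -/
structure OrderRule where
  lt : ∀ {n : ℕ}, Digraph (Fin n) → Fin n → Fin n → Prop
  compatible : ∀ {n : ℕ} (G : Digraph (Fin n)), G.ReachCompatible (lt G)

/-- A PAFP instance on some vertex set `{0, …, n - 1}`, as it is handed to a machine. -/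
structure PAFPInstance where
  n : ℕ
  inst : PAFP (Fin n)

/-- The PAFP instances whose digraph is acyclic. -/
abbrev DAGInstance : Type := {I : PAFPInstance // I.inst.G.IsDAG}

/-- The number `k` in unary, followed by the terminator `false`. -/
def unaryCode (k : ℕ) : List Bool := List.replicate k true ++ [false]

open Classical in
/-- The bits of an `n × n` Boolean matrix, row by row. -/
noncomputable def matrixCode {n : ℕ} (R : Fin n → Fin n → Prop) : List Bool :=
  (List.finRange n).flatMap fun u => (List.finRange n).map fun v => decide (R u v)

/-- The encoding of an instance as a bit string: the number of vertices, `s` and `t` in unary,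
the adjacency matrix of the digraph, and the adjacency matrix of the set of forbidden pairs. -/
noncomputable def PAFPInstance.encode (I : PAFPInstance) : List Bool :=
  unaryCode I.n ++ unaryCode I.inst.s ++ unaryCode I.inst.t ++
    matrixCode I.inst.G.Adj ++ matrixCode fun u v => s(u, v) ∈ I.inst.F

/-- The same encoding, on acyclic instances. -/
noncomputable def DAGInstance.encode (I : DAGInstance) : List Bool := I.1.encode

/-! The construction takes `n` layers of copies of `V`, the copy of `v` in layer `a` having number
`a * n + v`, a guard for every copy, and a chain of `2 * (n * n)` vertices that begins at the new
source. Copies of `u` and `v` are joined from a higher to a lower layer if `(u, v)` is an arc or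
`{u, v}` is forbidden. Every second chain vertex leads to a guard, every guard to its copy, and the
end of the chain to all copies of `s`. The forbidden pairs are each guard with its copy, and copies,
in different layers, of forbidden pairs.

Width: every forbidden pair is already joined by an arc of the new acyclic digraph, and a compatible
order directs all arcs forward. So the union digraph is the digraph itself, whatever the rule
(`unionDigraph_normalize`). Counting from `0`, chain vertex `d` has distance `d`, guard `m` has
distance `2 * m + 1` and copy `m` has distance `2 * m + 2`. Arcs between copies lower the number,
and the end of the chain is too far away to give shortcuts. Hence a BFS layer holds at most one
chain vertex and one other vertex (`bfsWidth_normalize`).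

Equivalence: the only arc out of a guard leads to its copy, with which it is forbidden. Guards thus
shorten distances but carry no safe path to the target. A safe path runs through the whole chain,
enters a copy of `s` and descends through the layers without the arcs that stem from forbidden
pairs. It projects to a walk of `G`, which is a path by acyclicity; as its vertices come from
different layers, safety is inherited. Conversely, a path has at most `n` vertices and fits into the
layers when a vertex is put into the layer given by the number of arcs that remain.

Complexity: the layers replace a topological sort, so each entry of the new matrices is an
arithmetic condition on its indices and the input bits. Nested loops print these entries;
`Printer.runs_compile` bounds their time as stack programs, and `Prog.Runs.simulate` turns stack
programs into Turing machines. -/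

/-! ### A while language on stacks of bits -/

/-- Programs of a while language whose registers, indexed by natural numbers, are stacks of
bits. Tests inspect the top of a stack, without popping it. -/
inductive Prog where
  | skip : Prog
  | push (k : ℕ) (b : Bool) : Prog
  | pop (k : ℕ) : Prog
  | seq (P Q : Prog) : Prog
  | ite (k : ℕ) (test : Option Bool → Bool) (P Q : Prog) : Prog
  | while (k : ℕ) (test : Option Bool → Bool) (P : Prog) : Prog

namespace Prog

open Function

/-- `P.Runs S S' c`: started on the stacks `S`, the program `P` stops with the stacks `S'` after
at most `c` steps. -/
inductive Runs : Prog → (ℕ → List Bool) → (ℕ → List Bool) → ℕ → Prop where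
  | skip (S) : Runs skip S S 1
  | push (S k b) : Runs (push k b) S (update S k (b :: S k)) 1
  | pop (S k) : Runs (pop k) S (update S k (S k).tail) 1
  | seq {P Q S₁ S₂ S₃ c₁ c₂} :
      Runs P S₁ S₂ c₁ → Runs Q S₂ S₃ c₂ → Runs (seq P Q) S₁ S₃ (c₁ + c₂)
  | iteTrue {k test P Q S S' c} :
      test (S k).head? = true → Runs P S S' c → Runs (ite k test P Q) S S' (c + 1)
  | iteFalse {k test P Q S S' c} :
      test (S k).head? = false → Runs Q S S' c → Runs (ite k test P Q) S S' (c + 1)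
  | whileTrue {k test P S₁ S₂ S₃ c₁ c₂} :
      test (S₁ k).head? = true → Runs P S₁ S₂ c₁ → Runs (Prog.while k test P) S₂ S₃ c₂ →
        Runs (Prog.while k test P) S₁ S₃ (c₁ + c₂ + 1)
  | whileFalse {k test P S} :
      test (S k).head? = false → Runs (Prog.while k test P) S S 1
  | mono {P S S' c c'} : Runs P S S' c → c ≤ c' → Runs P S S' c'

/-- All registers of the program are smaller than `R`. -/
def Below (R : ℕ) : Prog → Prop
  | skip => True
  | push k _ => k < R
  | pop k => k < R
  | seq P Q => P.Below R ∧ Q.Below R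
  | ite k _ P Q => k < R ∧ P.Below R ∧ Q.Below R
  | .while k _ P => k < R ∧ P.Below R

theorem Below.mono {R R' : ℕ} (h : R ≤ R') : ∀ {P : Prog}, P.Below R → P.Below R'
  | skip, _ => trivial
  | push _ _, hP => lt_of_lt_of_le hP h
  | pop _, hP => lt_of_lt_of_le hP h
  | seq _ _, hP => ⟨hP.1.mono h, hP.2.mono h⟩
  | ite _ _ _ _, hP => ⟨hP.1.trans_le h, hP.2.1.mono h, hP.2.2.mono h⟩
  | .while _ _ _, hP => ⟨hP.1.trans_le h, hP.2.mono h⟩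

theorem exists_below : ∀ P : Prog, ∃ R, P.Below R
  | skip => ⟨0, trivial⟩
  | push k _ => ⟨k + 1, Nat.lt_succ_self k⟩
  | pop k => ⟨k + 1, Nat.lt_succ_self k⟩
  | seq P Q => by
    obtain ⟨a, ha⟩ := exists_below P
    obtain ⟨b, hb⟩ := exists_below Q
    exact ⟨a + b, ha.mono (by omega), hb.mono (by omega)⟩
  | ite k _ P Q => by
    obtain ⟨a, ha⟩ := exists_below P
    obtain ⟨b, hb⟩ := exists_below Q
    exact ⟨k + 1 + a + b, by omega, ha.mono (by omega), hb.mono (by omega)⟩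
  | .while k _ P => by
    obtain ⟨a, ha⟩ := exists_below P
    exact ⟨k + 1 + a, by omega, ha.mono (by omega)⟩

/-! ### Compilation to a Turing machine -/

/-- The labels of the Turing machine code of a program. -/
def Lab : Prog → Type
  | skip => Unit
  | push _ _ => Unit
  | pop _ => Unit
  | seq P Q => P.Lab ⊕ Q.Lab
  | ite _ _ P Q => Option (P.Lab ⊕ Q.Lab)
  | .while _ _ P => Option P.Lab

noncomputable instance Lab.instFintype : ∀ P : Prog, Fintype P.Lab
  | skip => inferInstanceAs (Fintype Unit)
  | push _ _ => inferInstanceAs (Fintype Unit)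
  | pop _ => inferInstanceAs (Fintype Unit)
  | seq P Q =>
    have := Lab.instFintype P
    have := Lab.instFintype Q
    inferInstanceAs (Fintype (P.Lab ⊕ Q.Lab))
  | ite _ _ P Q =>
    have := Lab.instFintype P
    have := Lab.instFintype Q
    inferInstanceAs (Fintype (Option (P.Lab ⊕ Q.Lab)))
  | .while _ _ P =>
    have := Lab.instFintype P
    inferInstanceAs (Fintype (Option P.Lab))

/-- The label at which the code of a program is entered. -/
def entry : ∀ P : Prog, P.Lab
  | skip => ()
  | push _ _ => ()
  | pop _ => ()
  | seq P _ => Sum.inl P.entry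
  | ite _ _ _ _ => (none : Option _)
  | .while _ _ _ => (none : Option _)

variable (R : ℕ) [NeZero R]

/-- Statements of the stack machines with `R` stacks of bits. -/
abbrev Code (L : Type) : Type := Turing.TM2.Stmt (fun _ : Fin R => Bool) L (Option Bool)

open Turing.TM2.Stmt in
/-- The code of a program, as part of a machine with labels `L`: the labels of the program are
embedded by `emb`, and the code is left to `exit`. -/
def code {L : Type} : ∀ P : Prog, (P.Lab → L) → L → P.Lab → Code R L
  | skip, _, exit, _ => goto fun _ => exit
  | push k b, _, exit, _ => Turing.TM2.Stmt.push (Fin.ofNat R k) (fun _ => b) (goto fun _ => exit)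
  | pop k, _, exit, _ => Turing.TM2.Stmt.pop (Fin.ofNat R k) (fun v _ => v) (goto fun _ => exit)
  | seq P Q, emb, exit, l =>
    match l with
    | Sum.inl l => P.code (fun x => emb (Sum.inl x)) (emb (Sum.inr Q.entry)) l
    | Sum.inr l => Q.code (fun x => emb (Sum.inr x)) exit l
  | ite k test P Q, emb, exit, l =>
    match l with
    | none => peek (Fin.ofNat R k) (fun _ o => o) (branch test
        (goto fun _ => emb (some (Sum.inl P.entry))) (goto fun _ => emb (some (Sum.inr Q.entry))))
    | some (Sum.inl l) => P.code (fun x => emb (some (Sum.inl x))) exit l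
    | some (Sum.inr l) => Q.code (fun x => emb (some (Sum.inr x))) exit l
  | .while k test P, emb, exit, l =>
    match l with
    | none => peek (Fin.ofNat R k) (fun _ o => o) (branch test
        (goto fun _ => emb (some P.entry)) (goto fun _ => exit))
    | some l => P.code (fun x => emb (some x)) (emb none) l

variable {R}

theorem restrict_update {k : ℕ} (hk : k < R) (S : ℕ → List Bool) (x : List Bool) :
    (fun i : Fin R => update S k x i) = update (fun i : Fin R => S i) (Fin.ofNat R k) x := by
  funext i
  by_cases h : i = Fin.ofNat R k
  · subst h
    simp [Nat.mod_eq_of_lt hk]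
  · have h' : (i : ℕ) ≠ k := by
      rintro rfl
      exact h (by simp)
    rw [update_of_ne h', update_of_ne h]

/-- Iterated steps of a stack machine. -/
abbrev stepN {L : Type} (M : L → Code R L) (c : ℕ)
    (x : Option (Turing.TM2.Cfg (fun _ : Fin R => Bool) L (Option Bool))) :=
  (flip bind (Turing.TM2.step M))^[c] x

/-- The machine `M` is arbitrary, apart from containing the code of `P` along `emb`, so that the
induction hypotheses apply to subprograms inside the full machine. Each instruction or test costs
one machine step; the internal state `v` is overwritten by every test. -/
theorem Runs.simulate {P : Prog} {S S' : ℕ → List Bool} {c : ℕ} (h : P.Runs S S' c) :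
    P.Below R → ∀ {L : Type} (M : L → Code R L) (emb : P.Lab → L) (exit : L),
      (∀ l, M (emb l) = P.code R emb exit l) → ∀ v : Option Bool,
        ∃ v' : Option Bool, ∃ c' ≤ c,
          stepN M c' (some ⟨some (emb P.entry), v, fun i => S i⟩)
            = some ⟨some exit, v', fun i => S' i⟩ := by
  induction h with
  | skip S =>
    intro _ L M emb exit hM v
    exact ⟨v, 1, le_rfl, by simp [stepN, flip, hM, code]⟩
  | push S k b =>
    intro hR L M emb exit hM v
    have hR' : k < R := hR
    refine ⟨v, 1, le_rfl, ?_⟩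
    simp [stepN, flip, hM, code, restrict_update hR', Nat.mod_eq_of_lt hR']
  | pop S k =>
    intro hR L M emb exit hM v
    have hR' : k < R := hR
    refine ⟨v, 1, le_rfl, ?_⟩
    simp [stepN, flip, hM, code, restrict_update hR', Nat.mod_eq_of_lt hR']
  | @seq P Q S₁ S₂ S₃ c₁ c₂ _ _ ih₁ ih₂ =>
    intro hR L M emb exit hM v
    obtain ⟨v₁, d₁, hd₁, h₁⟩ := ih₁ hR.1 M (fun x => emb (Sum.inl x)) (emb (Sum.inr Q.entry))
      (fun l => hM (Sum.inl l)) v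
    obtain ⟨v₂, d₂, hd₂, h₂⟩ := ih₂ hR.2 M (fun x => emb (Sum.inr x)) exit
      (fun l => hM (Sum.inr l)) v₁
    refine ⟨v₂, d₂ + d₁, by omega, ?_⟩
    rw [stepN, iterate_add_apply]
    exact (congrArg _ h₁).trans h₂
  | @iteTrue k test P Q S S' c ht _ ih =>
    intro hR L M emb exit hM v
    have hR' : k < R := hR.1
    obtain ⟨v₁, d₁, hd₁, h₁⟩ := ih hR.2.1 M (fun x => emb (some (Sum.inl x))) exit
      (fun l => hM (some (Sum.inl l))) (S k).head?
    refine ⟨v₁, d₁ + 1, by omega, ?_⟩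
    rw [stepN, iterate_succ_apply, ← h₁]
    congr 1
    have := hM none
    simp only [code] at this
    simp [flip, entry, this, Nat.mod_eq_of_lt hR', ht]
  | @iteFalse k test P Q S S' c ht _ ih =>
    intro hR L M emb exit hM v
    have hR' : k < R := hR.1
    obtain ⟨v₁, d₁, hd₁, h₁⟩ := ih hR.2.2 M (fun x => emb (some (Sum.inr x))) exit
      (fun l => hM (some (Sum.inr l))) (S k).head?
    refine ⟨v₁, d₁ + 1, by omega, ?_⟩
    rw [stepN, iterate_succ_apply, ← h₁]
    congr 1
    have := hM none
    simp only [code] at this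
    simp [flip, entry, this, Nat.mod_eq_of_lt hR', ht]
  | @whileTrue k test P S₁ S₂ S₃ c₁ c₂ ht _ _ ih₁ ih₂ =>
    intro hR L M emb exit hM v
    have hR' : k < R := hR.1
    obtain ⟨v₁, d₁, hd₁, h₁⟩ := ih₁ hR.2 M (fun x => emb (some x)) (emb none)
      (fun l => hM (some l)) (S₁ k).head?
    obtain ⟨v₂, d₂, hd₂, h₂⟩ := ih₂ hR M emb exit hM v₁
    refine ⟨v₂, d₂ + (d₁ + 1), by omega, ?_⟩
    rw [stepN, iterate_add_apply, iterate_succ_apply, ← h₂]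
    congr 1
    refine Eq.trans ?_ h₁
    rw [stepN]
    congr 1
    have := hM none
    simp only [code] at this
    simp [flip, entry, this, Nat.mod_eq_of_lt hR', ht]
  | @whileFalse k test P S ht =>
    intro hR L M emb exit hM v
    have hR' : k < R := hR.1
    refine ⟨(S k).head?, 1, by omega, ?_⟩
    have := hM none
    simp only [code] at this
    simp [stepN, flip, entry, this, Nat.mod_eq_of_lt hR', ht]
  | mono _ hc ih =>
    intro hR L M emb exit hM v
    obtain ⟨v₁, d₁, hd₁, h₁⟩ := ih hR M emb exit hM v
    exact ⟨v₁, d₁, hd₁.trans hc, h₁⟩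

/-- The Turing machine that runs the program and halts. -/
noncomputable def machine (R : ℕ) [NeZero R] (P : Prog) (i o : Fin R) : Turing.FinTM2 where
  K := Fin R
  k₀ := i
  k₁ := o
  Γ := fun _ => Bool
  Λ := Option P.Lab
  main := some P.entry
  σ := Option Bool
  initialState := none
  Γk₀Fin := inferInstanceAs (Fintype Bool)
  m := fun l => match l with
    -- A halting configuration must carry the initial internal state, so the trace of the last test
    -- is erased. This is the one extra step in the time bound below.
    | none => Turing.TM2.Stmt.load (fun _ => none) Turing.TM2.Stmt.halt
    | some l => P.code R some none l

/-- A map is computable in polynomial time if a program computes it, on the encodings as bit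
strings, from one register to another, within polynomially many steps. -/
theorem nonempty_polyTime {α β : Type} (ea : α → List Bool) (eb : β → List Bool) (f : α → β)
    (P : Prog) (i o : ℕ) (time : Polynomial ℕ)
    (h : ∀ a, P.Runs (update (fun _ => []) i (ea a)) (update (fun _ => []) o (eb (f a)))
      (time.eval (ea a).length)) :
    Nonempty (Turing.TM2ComputableInPolyTime ea eb f) := by
  obtain ⟨R, _, hi, ho, hR⟩ : ∃ R, NeZero R ∧ i < R ∧ o < R ∧ P.Below R := by
    obtain ⟨R₀, hR₀⟩ := P.exists_below
    exact ⟨R₀ + i + o + 1, inferInstance, by omega, by omega, hR₀.mono (by omega)⟩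
  refine ⟨⟨⟨machine R P (Fin.ofNat R i) (Fin.ofNat R o), Equiv.refl Bool, Equiv.refl Bool⟩,
    time + 1, fun a => ?_⟩⟩
  have key := (h a).simulate hR (machine R P (Fin.ofNat R i) (Fin.ofNat R o)).m some none
    (fun _ => rfl) none
  refine Classical.choice ?_
  obtain ⟨v, c, hc, hs⟩ := key
  refine ⟨⟨⟨c + 1, ?_⟩, by simpa using hc⟩⟩
  have hinit : Turing.initList (machine R P (Fin.ofNat R i) (Fin.ofNat R o))
      (List.map (Equiv.refl Bool).invFun (ea a)) =
      ⟨some (some P.entry), none, fun j : Fin R => update (fun _ => []) i (ea a) (j : ℕ)⟩ := by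
    unfold Turing.initList
    congr 1
    rw [restrict_update hi]
    funext j
    by_cases hj : j = Fin.ofNat R i
    · subst hj
      rw [update_self]
      exact (dif_pos rfl).trans (List.map_id _)
    · exact (dif_neg hj).trans (update_of_ne hj _ (fun _ : Fin R => ([] : List Bool))).symm
  have hhalt : Turing.haltList (machine R P (Fin.ofNat R i) (Fin.ofNat R o))
      (List.map (Equiv.refl Bool).invFun (eb (f a))) =
      ⟨none, none, fun j : Fin R => update (fun _ => []) o (eb (f a)) (j : ℕ)⟩ := by
    unfold Turing.haltList
    congr 1
    rw [restrict_update ho]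
    funext j
    by_cases hj : j = Fin.ofNat R o
    · subst hj
      rw [update_self]
      exact (dif_pos rfl).trans (List.map_id _)
    · exact (dif_neg hj).trans (update_of_ne hj _ (fun _ : Fin R => ([] : List Bool))).symm
  refine (iterate_succ_apply' _ _ _).trans ?_
  refine (congrArg _ ((congrArg _ (congrArg some hinit)).trans hs)).trans ?_
  exact congrArg some hhalt.symm

end Prog

/-! ### Arithmetic expressions and printers -/

open Function

/-- Arithmetic expressions in numerical variables and the bits of an array. -/
inductive Expr where
  | var (k : ℕ) : Expr
  | const (c : ℕ) : Expr
  | add (e₁ e₂ : Expr) : Expr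
  | mul (e₁ e₂ : Expr) : Expr
  | sub (e₁ e₂ : Expr) : Expr
  | bit (e : Expr) : Expr

namespace Expr

/-- The value of an expression; subtraction is truncated, and positions beyond the end of the
array read `0`. -/
def eval (w : List Bool) (ρ : ℕ → ℕ) : Expr → ℕ
  | var k => ρ k
  | const c => c
  | add e₁ e₂ => e₁.eval w ρ + e₂.eval w ρ
  | mul e₁ e₂ => e₁.eval w ρ * e₂.eval w ρ
  | sub e₁ e₂ => e₁.eval w ρ - e₂.eval w ρ
  | bit e => if w[e.eval w ρ]? = some true then 1 else 0

/-- All variables of the expression are smaller than `d`. -/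
def Below (d : ℕ) : Expr → Prop
  | var k => k < d
  | const _ => True
  | add e₁ e₂ => e₁.Below d ∧ e₂.Below d
  | mul e₁ e₂ => e₁.Below d ∧ e₂.Below d
  | sub e₁ e₂ => e₁.Below d ∧ e₂.Below d
  | bit e => e.Below d

theorem eval_congr (w : List Bool) {ρ ρ' : ℕ → ℕ} {d : ℕ} (h : ∀ k < d, ρ k = ρ' k) :
    ∀ {e : Expr}, e.Below d → e.eval w ρ = e.eval w ρ'
  | var _, he => h _ he
  | const _, _ => rfl
  | add _ _, he => congrArg₂ (· + ·) (eval_congr w h he.1) (eval_congr w h he.2)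
  | mul _ _, he => congrArg₂ (· * ·) (eval_congr w h he.1) (eval_congr w h he.2)
  | sub _ _, he => congrArg₂ (· - ·) (eval_congr w h he.1) (eval_congr w h he.2)
  | bit e, he => by simp only [eval, eval_congr w h (e := e) he]

end Expr

/-! ### Elementary routines on unary registers and on the array -/

namespace Prog

/-- The stacks that represent the array `w`, the auxiliary stack `x`, the output `o` and, in unary,
the values `ρ` of the variables. -/
def store (w x o : List Bool) (ρ : ℕ → ℕ) : ℕ → List Bool
  | 0 => w
  | 1 => x
  | 2 => o
  | k + 3 => List.replicate (ρ k) true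

variable {w x o : List Bool} {ρ : ℕ → ℕ}

theorem update_store_zero (l : List Bool) : update (store w x o ρ) 0 l = store l x o ρ := by
  funext i; rcases i with _ | _ | _ | i <;> rfl

theorem update_store_one (l : List Bool) : update (store w x o ρ) 1 l = store w l o ρ := by
  funext i; rcases i with _ | _ | _ | i <;> rfl

theorem update_store_two (l : List Bool) : update (store w x o ρ) 2 l = store w x l ρ := by
  funext i; rcases i with _ | _ | _ | i <;> rfl

theorem update_store_var (k m : ℕ) :
    update (store w x o ρ) (k + 3) (List.replicate m true) = store w x o (update ρ k m) := by
  funext i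
  rcases i with _ | _ | _ | i
  · rfl
  · rfl
  · rfl
  · by_cases h : i = k
    · subst h
      simp [store]
    · rw [update_of_ne (by omega)]
      simp [store, h]

/-- Increment a variable. -/
def inc (k : ℕ) : Prog := push (k + 3) true

/-- Decrement a variable. -/
def dec (k : ℕ) : Prog := pop (k + 3)

/-- Repeat `P` as often as the variable `k` says, decrementing it before each round. -/
def loop (k : ℕ) (P : Prog) : Prog :=
  .while (k + 3) (fun b => b.isSome) (seq (dec k) P)

theorem runs_inc (k : ℕ) :
    (inc k).Runs (store w x o ρ) (store w x o (update ρ k (ρ k + 1))) 1 := by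
  have := Runs.push (store w x o ρ) (k + 3) true
  rwa [show true :: store w x o ρ (k + 3) = List.replicate (ρ k + 1) true from rfl,
    update_store_var] at this

theorem runs_dec (k : ℕ) :
    (dec k).Runs (store w x o ρ) (store w x o (update ρ k (ρ k - 1))) 1 := by
  have := Runs.pop (store w x o ρ) (k + 3)
  rwa [show (store w x o ρ (k + 3)).tail = List.replicate (ρ k - 1) true by simp [store],
    update_store_var] at this

/-- The rule for loops: `T j` are the values when `j` rounds are left. -/
theorem runs_loop {P : Prog} {k c : ℕ} (W X O : ℕ → List Bool) (T : ℕ → ℕ → ℕ)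
    (hT : ∀ j, T j k = j)  :
    ∀ m : ℕ, (∀ j < m, P.Runs (store (W (j + 1)) (X (j + 1)) (O (j + 1)) (update (T (j + 1)) k j))
        (store (W j) (X j) (O j) (T j)) c) →
      (loop k P).Runs (store (W m) (X m) (O m) (T m)) (store (W 0) (X 0) (O 0) (T 0))
        (m * (c + 2) + 1)
  | 0, _ => by
    refine (Runs.whileFalse ?_).mono (by omega)
    simp [store, hT]
  | m + 1, hP => by
    have h₁ := hP m (Nat.lt_succ_self m)
    have h₂ := runs_loop W X O T hT m fun j hj => hP j (by omega)
    have h₀ := runs_dec (w := W (m + 1)) (x := X (m + 1)) (o := O (m + 1)) (ρ := T (m + 1)) k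
    rw [hT, Nat.add_sub_cancel] at h₀
    refine (Runs.whileTrue ?_ (h₀.seq h₁) h₂).mono (by ring_nf; omega)
    simp [store, hT]


theorem Runs.of_eq {P : Prog} {S S' T T' : ℕ → List Bool} {c c' : ℕ} (h : P.Runs S S' c)
    (hS : S = T) (hS' : S' = T') (hc : c ≤ c') : P.Runs T T' c' := by
  subst hS hS'
  exact h.mono hc

/-- Add the variable `k` to the variable `d`, with the help of the variable `f`. -/
def copy (k d f : ℕ) : Prog := seq (loop k (inc f)) (loop f (seq (inc k) (inc d)))

/-- Reading a unary register empties it: `k` is first moved to `f`, and then restored while `d` is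
incremented. The rounds cost three and four steps per unit. -/
theorem runs_copy {k d f : ℕ} (hkd : k < d) (hdf : d < f) (hf : ρ f = 0) :
    (copy k d f).Runs (store w x o ρ) (store w x o (update ρ d (ρ d + ρ k)))
      (7 * ρ k + 2) := by
  have h₁ := runs_loop (P := inc f) (k := k) (c := 1) (fun _ => w) (fun _ => x) (fun _ => o)
    (fun j => update (update ρ k j) f (ρ k - j)) (by intro j; simp [update_apply]; omega) (ρ k) (by
      intro j hj
      refine (runs_inc f).of_eq rfl ?_ le_rfl
      congr 1
      funext i
      simp only [update_apply]
      split_ifs <;> omega)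
  have h₂ := runs_loop (P := seq (inc k) (inc d)) (k := f) (c := 2) (fun _ => w) (fun _ => x)
    (fun _ => o) (fun j => update (update (update ρ d (ρ d + (ρ k - j))) k (ρ k - j)) f j)
    (by intro j; simp) (ρ k) (by
      intro j hj
      refine ((runs_inc k).seq (runs_inc d)).of_eq rfl ?_ le_rfl
      congr 1
      funext i
      simp only [update_apply]
      split_ifs <;> omega)
  refine Runs.of_eq (h₁.seq (h₂.of_eq ?_ rfl le_rfl)) ?_ ?_ (by omega)
  all_goals
    congr 1
    funext i
    simp only [update_apply]
    split_ifs <;> simp_all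

/-- Add a constant to the variable `d`. -/
def addConst (d : ℕ) : ℕ → Prog
  | 0 => skip
  | c + 1 => seq (inc d) (addConst d c)

theorem runs_addConst (d : ℕ) : ∀ (c : ℕ) (ρ : ℕ → ℕ),
    (addConst d c).Runs (store w x o ρ) (store w x o (update ρ d (ρ d + c))) (c + 1)
  | 0, ρ => by simpa [addConst] using Runs.skip (store w x o ρ)
  | c + 1, ρ => by
    refine ((runs_inc d).seq (runs_addConst d c _)).of_eq rfl ?_ (by omega)
    simp [add_comm, add_left_comm]

/-- Move a bit from the top of one stack to another one. -/
def moveTop (a b : ℕ) : Prog :=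
  seq (ite a (fun y => y == some true) (push b true) (push b false)) (pop a)

theorem runs_moveTop {a b : ℕ} (hab : a ≠ b) {S : ℕ → List Bool} {y : Bool} {l : List Bool}
    (h : S a = y :: l) :
    (moveTop a b).Runs S (update (update S b (y :: S b)) a l) 3 := by
  have h₁ : (ite a (fun y => y == some true) (push b true) (push b false)).Runs S
      (update S b (y :: S b)) 2 := by
    cases y
    · exact Runs.iteFalse (by simp [h]) (Runs.push _ _ _)
    · exact Runs.iteTrue (by simp [h]) (Runs.push _ _ _)
  refine (h₁.seq (Runs.pop _ _)).of_eq rfl ?_ le_rfl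
  simp [update_of_ne hab, h]

/-- Move the top of the array to the auxiliary stack, as often as the variable `f` says. -/
def unwind (f : ℕ) : Prog := loop f (ite 0 (fun y => y.isSome) (moveTop 0 1) skip)

theorem runs_unwind (f : ℕ) :
    (unwind f).Runs (store w [] o ρ)
      (store (w.drop (ρ f)) (w.take (ρ f)).reverse o (update ρ f 0)) (ρ f * 6 + 1) := by
  have h := runs_loop (P := ite 0 (fun y => y.isSome) (moveTop 0 1) skip) (k := f) (c := 4)
    (fun j => w.drop (ρ f - j)) (fun j => (w.take (ρ f - j)).reverse) (fun _ => o)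
    (fun j => update ρ f j) (by intro j; simp) (ρ f) (by
      intro j hj
      have hs : ρ f - j = (ρ f - (j + 1)) + 1 := by omega
      generalize hi : ρ f - (j + 1) = i at hs
      by_cases hw : i < w.length
      · have hd : w.drop i = w[i] :: w.drop (i + 1) := List.drop_eq_getElem_cons hw
        refine (Runs.iteTrue ?_ (runs_moveTop (y := w[i]) (l := w.drop (i + 1)) (by omega)
          ?_)).of_eq rfl ?_ le_rfl
        · simp only [store, hd, List.head?_cons, Option.isSome_some]
        · exact hd
        · rw [update_store_one, update_store_zero, hs, List.take_succ_eq_append_getElem hw,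
            List.reverse_append, update_idem]
          rfl
      -- Beyond the end of the array a round moves nothing, and `drop` and `take` no longer change
      -- either.
      · have h0 : w.drop i = [] := List.drop_eq_nil_of_le (by omega)
        have h1 : w.drop (i + 1) = [] := List.drop_eq_nil_of_le (by omega)
        refine (Runs.iteFalse ?_ (Runs.skip _)).of_eq rfl ?_ (by omega)
        · simp [store, h0]
        · simp [hs, h0, h1, List.take_of_length_le (show w.length ≤ i by omega),
            List.take_of_length_le (show w.length ≤ i + 1 by omega)])
  refine h.of_eq ?_ ?_ le_rfl <;> simp

/-- Move the auxiliary stack back to the array. -/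
def rewind : Prog := .while 1 (fun y => y.isSome) (moveTop 1 0)

theorem runs_rewind : ∀ (x w : List Bool),
    rewind.Runs (store w x o ρ) (store (x.reverse ++ w) [] o ρ) (x.length * 4 + 1)
  | [], w => Runs.whileFalse (by simp [store])
  | y :: x, w => by
    refine (Runs.whileTrue ?_ ((runs_moveTop (y := y) (l := x) (by omega) ?_).of_eq rfl ?_ le_rfl)
      (runs_rewind x (y :: w))).of_eq rfl ?_ ?_
    · simp [store]
    · simp [store]
    · rw [update_store_zero, update_store_one]
      simp [store]
    · simp
    · simp; omega

end Prog

/-! ### Evaluation of expressions in polynomial time -/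

namespace Expr

open Prog Polynomial

/-- The program that adds the value of the expression to the variable `d`, with the help of the
variables from `f` on. -/
def compile : Expr → ℕ → ℕ → Prog
  | var k, d, f => copy k d f
  | const c, d, _ => addConst d c
  | add e₁ e₂, d, f => .seq (e₁.compile d f) (e₂.compile d f)
  | mul e₁ e₂, d, f => .seq (e₁.compile f (f + 1)) (loop f (e₂.compile d (f + 1)))
  | sub e₁ e₂, d, f =>
    .seq (e₁.compile f (f + 1)) (.seq (e₂.compile (f + 1) (f + 2))
      (.seq (loop (f + 1) (dec f)) (loop f (inc d))))
  | bit e, d, f =>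
    .seq (e.compile f (f + 1)) (.seq (unwind f)
      (.seq (.ite 0 (fun y => y == some true) (inc d) .skip) rewind))

/-- A bound for the value of an expression, in terms of a bound for its variables. -/
noncomputable def valueBound : Expr → ℕ[X]
  | var _ => X
  | const c => C c
  | add e₁ e₂ => e₁.valueBound + e₂.valueBound
  | mul e₁ e₂ => e₁.valueBound * e₂.valueBound
  | sub e₁ _ => e₁.valueBound
  | bit _ => 1

/-- A bound for the running time of the program of an expression. -/
noncomputable def timeBound : Expr → ℕ[X]
  | var _ => 7 * X + 2
  | const c => C c + 1
  | add e₁ e₂ => e₁.timeBound + e₂.timeBound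
  | mul e₁ e₂ => e₁.timeBound + (e₁.valueBound * (e₂.timeBound + 2) + 1)
  | sub e₁ e₂ => e₁.timeBound + (e₂.timeBound +
      ((e₂.valueBound * 3 + 1) + (e₁.valueBound * 3 + 1)))
  | bit e => e.timeBound + ((e.valueBound * 6 + 1) + (2 + (e.valueBound * 4 + 1)))

theorem eval_le_valueBound (w : List Bool) {ρ : ℕ → ℕ} {d B : ℕ} (hB : ∀ k < d, ρ k ≤ B) :
    ∀ {e : Expr}, e.Below d → e.eval w ρ ≤ e.valueBound.eval B
  | var k, he => by simpa [eval, valueBound] using hB k he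
  | const c, _ => by simp [eval, valueBound]
  | add _ _, he => by
    simpa [eval, valueBound] using
      add_le_add (eval_le_valueBound w hB he.1) (eval_le_valueBound w hB he.2)
  | mul _ _, he => by
    simpa [eval, valueBound] using
      Nat.mul_le_mul (eval_le_valueBound w hB he.1) (eval_le_valueBound w hB he.2)
  | sub _ _, he => by
    simpa [eval, valueBound] using (Nat.sub_le _ _).trans (eval_le_valueBound w hB he.1)
  | bit e, _ => by
    simp only [eval, valueBound]
    split_ifs <;> simp

/-- The variables of `e` lie below `b`, the result is accumulated in `d ≥ b`, and the scratch
variables from `f` on are zero before and after. Hence writing never alters an operand, and a factor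
can be evaluated anew in each round of a multiplication. Truncated subtraction comes from popping an
empty stack. -/
theorem runs_compile (w : List Bool) {o : List Bool} {B b : ℕ} :
    ∀ {e : Expr} {d f : ℕ} {ρ : ℕ → ℕ}, e.Below b → b ≤ d → d < f → (∀ k < b, ρ k ≤ B) →
      (∀ k, f ≤ k → ρ k = 0) →
      (e.compile d f).Runs (store w [] o ρ) (store w [] o (update ρ d (ρ d + e.eval w ρ)))
        (e.timeBound.eval B)
  | var k, d, f, ρ, he, hbd, hdf, hB, hf => by
    refine (runs_copy (lt_of_lt_of_le he hbd) hdf (hf f le_rfl)).mono ?_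
    have := hB k he
    simp [timeBound]
    omega
  | const c, d, f, ρ, _, _, _, _, _ => by
    simpa [timeBound, compile, eval] using runs_addConst d c ρ
  | add e₁ e₂, d, f, ρ, he, hbd, hdf, hB, hf => by
    have h₁ := runs_compile w (o := o) he.1 hbd hdf hB hf
    have hc : ∀ k < b, update ρ d (ρ d + e₁.eval w ρ) k = ρ k :=
      fun k hk => update_of_ne (by omega) _ _
    have h₂ := runs_compile w (o := o) he.2 hbd hdf (fun k hk => (hc k hk).trans_le (hB k hk))
      (fun k hk => (update_of_ne (by omega) _ _).trans (hf k hk))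
    rw [eval_congr w hc he.2] at h₂
    refine (h₁.seq h₂).of_eq rfl ?_ ?_
    · simp [eval, add_assoc]
    · simp [timeBound]
  | mul e₁ e₂, d, f, ρ, he, hbd, hdf, hB, hf => by
    have h₁ := runs_compile w (o := o) he.1 (by omega) (Nat.lt_succ_self f) hB
      (fun k hk => hf k (by omega))
    have h₂ := runs_loop (P := e₂.compile d (f + 1)) (k := f) (c := e₂.timeBound.eval B)
      (fun _ => w) (fun _ => []) (fun _ => o)
      (fun j => update (update ρ d (ρ d + (e₁.eval w ρ - j) * e₂.eval w ρ)) f j)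
      (by intro j; simp) (e₁.eval w ρ) (by
        intro j hj
        have hc : ∀ k < b, update (update (update ρ d (ρ d + (e₁.eval w ρ - (j + 1)) *
            e₂.eval w ρ)) f (j + 1)) f j k = ρ k := by
          intro k hk
          rw [update_of_ne (by omega), update_of_ne (by omega), update_of_ne (by omega)]
        have h := runs_compile w (o := o) he.2 hbd (show d < f + 1 by omega)
          (fun k hk => (hc k hk).trans_le (hB k hk)) (fun k hk => by
            rw [update_of_ne (by omega), update_of_ne (by omega), update_of_ne (by omega)]
            exact hf k (by omega))
        rw [eval_congr w hc he.2] at h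
        refine h.of_eq rfl ?_ le_rfl
        congr 1
        have hs : e₁.eval w ρ - j = (e₁.eval w ρ - (j + 1)) + 1 := by omega
        funext i
        simp only [update_apply, hs, Nat.succ_mul]
        split_ifs <;> omega)
    refine (h₁.seq (h₂.of_eq ?_ rfl le_rfl)).of_eq rfl ?_ ?_
    · congr 1
      simp [hf f le_rfl]
    · congr 1
      have := hf f le_rfl
      funext i
      simp only [update_apply, eval, Nat.sub_zero]
      split_ifs <;> simp_all
    · have := Nat.mul_le_mul_right (e₂.timeBound.eval B + 2) (eval_le_valueBound w hB he.1)
      simpa [timeBound] using this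
  | sub e₁ e₂, d, f, ρ, he, hbd, hdf, hB, hf => by
    have hf₀ := hf f le_rfl
    have hf₁ := hf (f + 1) (by omega)
    have h₁ := runs_compile w (o := o) he.1 (by omega) (Nat.lt_succ_self f) hB
      (fun k hk => hf k (by omega))
    have hc : ∀ k < b, update ρ f (ρ f + e₁.eval w ρ) k = ρ k :=
      fun k hk => update_of_ne (by omega) _ _
    have h₂ := runs_compile w (o := o) he.2 (show b ≤ f + 1 by omega) (show f + 1 < f + 2 by omega)
      (fun k hk => (hc k hk).trans_le (hB k hk)) (fun k hk => by
        rw [update_of_ne (by omega)]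
        exact hf k (by omega))
    rw [eval_congr w hc he.2] at h₂
    have h₃ := runs_loop (P := dec f) (k := f + 1) (c := 1)
      (fun _ => w) (fun _ => []) (fun _ => o)
      (fun j => update (update ρ f (e₁.eval w ρ - (e₂.eval w ρ - j))) (f + 1) j)
      (by intro j; simp) (e₂.eval w ρ) (by
        intro j hj
        refine (runs_dec f).of_eq rfl ?_ le_rfl
        congr 1
        funext i
        simp only [update_apply]
        split_ifs <;> omega)
    have h₄ := runs_loop (P := inc d) (k := f) (c := 1)
      (fun _ => w) (fun _ => []) (fun _ => o)
      (fun j => update (update ρ d (ρ d + (e₁.eval w ρ - e₂.eval w ρ - j))) f j)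
      (by intro j; simp) (e₁.eval w ρ - e₂.eval w ρ) (by
        intro j hj
        refine (runs_inc d).of_eq rfl ?_ le_rfl
        congr 1
        funext i
        simp only [update_apply]
        split_ifs <;> omega)
    refine (h₁.seq (h₂.seq ((h₃.of_eq ?_ rfl le_rfl).seq (h₄.of_eq ?_ rfl le_rfl)))).of_eq
      rfl ?_ ?_
    · congr 1
      funext i
      simp only [update_apply]
      split_ifs <;> omega
    · congr 1
      funext i
      simp only [update_apply]
      split_ifs <;> subst_vars <;> omega
    · congr 1
      funext i
      simp only [update_apply, eval]
      split_ifs <;> subst_vars <;> omega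
    · have v₁ := eval_le_valueBound w hB he.1
      have v₂ := eval_le_valueBound w hB he.2
      simp [timeBound]
      omega
  | bit e, d, f, ρ, he, hbd, hdf, hB, hf => by
    have hf₀ := hf f le_rfl
    have h₁ := runs_compile (e := e) w (o := o) he (by omega) (Nat.lt_succ_self f) hB
      (fun k hk => hf k (by omega))
    have h₂ := runs_unwind (w := w) (o := o) (ρ := update ρ f (ρ f + e.eval w ρ)) f
    rw [update_self, hf₀, zero_add] at h₂
    rw [hf₀, zero_add] at h₁
    have h₃ : (Prog.ite 0 (fun y => y == some true) (inc d) .skip).Runs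
        (store (w.drop (e.eval w ρ)) (w.take (e.eval w ρ)).reverse o ρ)
        (store (w.drop (e.eval w ρ)) (w.take (e.eval w ρ)).reverse o
          (update ρ d (ρ d + (bit e).eval w ρ))) 2 := by
      by_cases hw : w[e.eval w ρ]? = some true
      · refine (Runs.iteTrue ?_ (runs_inc d)).of_eq rfl ?_ le_rfl
        · simp [store, hw]
        · simp [eval, hw]
      · refine (Runs.iteFalse ?_ (Runs.skip _)).of_eq rfl ?_ le_rfl
        · simp [store, hw]
        · simp [eval, hw]
    have h₄ := runs_rewind (o := o) (ρ := update ρ d (ρ d + (bit e).eval w ρ))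
      (w.take (e.eval w ρ)).reverse (w.drop (e.eval w ρ))
    refine (h₁.seq (h₂.seq ((h₃.of_eq ?_ rfl le_rfl).seq h₄))).of_eq rfl ?_ ?_
    · congr 1
      funext i
      simp only [update_apply]
      split_ifs <;> simp_all
    · simp
    · have v₁ := eval_le_valueBound w hB (e := e) he
      have v₂ : (w.take (e.eval w ρ)).reverse.length ≤ e.eval w ρ := by simp
      simp only [timeBound, eval_add, eval_mul, eval_ofNat, eval_one]
      omega

end Expr

/-! ### Printers and their running time -/

open Expr Prog Polynomial

/-- Programs that print a bit string. The variable of a loop is the first unused one. -/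
inductive Printer where
  | emit (e : Expr) : Printer
  | seq (p q : Printer) : Printer
  | for (e : Expr) (p : Printer) : Printer

namespace Printer

/-- The printed bit string, where the variables from `f` on are unused. An expression is printed as
the bit that tells whether it is non-zero. -/
def print (w : List Bool) : Printer → ℕ → (ℕ → ℕ) → List Bool
  | emit e, _, ρ => [decide (e.eval w ρ ≠ 0)]
  | seq p q, f, ρ => p.print w f ρ ++ q.print w f ρ
  | .for e p, f, ρ => (List.range (e.eval w ρ)).flatMap fun i => p.print w (f + 1) (update ρ f i)

/-- No variable from `f` on occurs free in the printer. -/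
def Closed : Printer → ℕ → Prop
  | emit e, f => e.Below f
  | seq p q, f => p.Closed f ∧ q.Closed f
  | .for e p, f => e.Below f ∧ p.Closed (f + 1)

/-- The program of a printer. As the output is a stack, it is printed from its end. -/
def compile : Printer → ℕ → Prog
  | emit e, f => .seq (e.compile f (f + 1))
      (.seq (.ite (f + 3) (fun y => y.isSome) (.push 2 true) (.push 2 false)) (loop f .skip))
  | seq p q, f => .seq (q.compile f) (p.compile f)
  | .for e p, f => .seq (e.compile f (f + 1)) (loop f (p.compile (f + 1)))

/-- A bound for the running time of the program of a printer. -/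
noncomputable def timeBound : Printer → ℕ[X]
  | emit e => e.timeBound + (2 + (e.valueBound * 3 + 1))
  | seq p q => q.timeBound + p.timeBound
  | .for e p => e.timeBound + (e.valueBound * (p.timeBound.comp (X + e.valueBound) + 2) + 1)

/-- Loops count down while output is pushed on a stack; the two reversals cancel, and the output
appears in increasing order of the loop variable. -/
theorem runs_compile (w : List Bool) : ∀ {p : Printer} {o : List Bool} {f B : ℕ} {ρ : ℕ → ℕ},
    p.Closed f → (∀ k < f, ρ k ≤ B) → (∀ k, f ≤ k → ρ k = 0) →
      (p.compile f).Runs (store w [] o ρ) (store w [] (p.print w f ρ ++ o) ρ)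
        (p.timeBound.eval B)
  | emit e, o, f, B, ρ, hp, hB, hf => by
    have h₁ := e.runs_compile w (o := o) hp le_rfl (Nat.lt_succ_self f) hB
      (fun k hk => hf k (by omega))
    rw [hf f le_rfl, zero_add] at h₁
    have h₂ : (Prog.ite (f + 3) (fun y => y.isSome) (.push 2 true) (.push 2 false)).Runs
        (store w [] o (update ρ f (e.eval w ρ)))
        (store w [] (decide (e.eval w ρ ≠ 0) :: o) (update ρ f (e.eval w ρ))) 2 := by
      by_cases h : e.eval w ρ = 0
      · refine (Runs.iteFalse ?_ (Runs.push _ _ _)).of_eq rfl ?_ le_rfl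
        · simp [store, h]
        · rw [update_store_two]
          simp [store, h]
      · refine (Runs.iteTrue ?_ (Runs.push _ _ _)).of_eq rfl ?_ le_rfl
        · simp [store, h]
        · rw [update_store_two]
          simp [store, h]
    have h₃ := runs_loop (P := .skip) (k := f) (c := 1) (fun _ => w) (fun _ => [])
      (fun _ => decide (e.eval w ρ ≠ 0) :: o) (fun j => update ρ f j) (by intro j; simp)
      (e.eval w ρ) (fun j _ => (Runs.skip _).of_eq rfl (by simp) le_rfl)
    refine (h₁.seq (h₂.seq h₃)).of_eq rfl ?_ ?_
    · simp [print, ← hf f le_rfl]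
    · have := eval_le_valueBound w hB hp
      simp [timeBound]
      omega
  | seq p q, o, f, B, ρ, hp, hB, hf => by
    refine ((runs_compile w hp.2 hB hf).seq (runs_compile w hp.1 hB hf)).of_eq rfl ?_ ?_
    · simp [print]
    · simp [timeBound]
  | .for e p, o, f, B, ρ, hp, hB, hf => by
    have h₁ := e.runs_compile w (o := o) hp.1 le_rfl (Nat.lt_succ_self f) hB
      (fun k hk => hf k (by omega))
    rw [hf f le_rfl, zero_add] at h₁
    have hv := eval_le_valueBound w hB hp.1
    have h₂ := runs_loop (P := p.compile (f + 1)) (k := f)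
      (c := p.timeBound.eval (B + e.valueBound.eval B)) (fun _ => w) (fun _ => [])
      -- With `j` rounds left, the output for the indices from `j` on is already printed; the
      -- decremented counter serves as the index of the round.
      (fun j => ((List.range' j (e.eval w ρ - j)).flatMap
        fun i => p.print w (f + 1) (update ρ f i)) ++ o)
      (fun j => update ρ f j) (by intro j; simp) (e.eval w ρ) (by
        intro j hj
        rw [update_idem]
        refine (runs_compile w hp.2 (fun k hk => ?_) (fun k hk => ?_)).of_eq rfl ?_ le_rfl
        · rw [update_apply]
          split_ifs with h
          · omega
          · exact (hB k (by omega)).trans (Nat.le_add_right _ _)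
        · rw [update_of_ne (by omega)]
          exact hf k (by omega)
        · congr 1
          rw [show e.eval w ρ - j = (e.eval w ρ - (j + 1)) + 1 by omega, List.range'_succ]
          simp)
    refine (h₁.seq (h₂.of_eq ?_ rfl le_rfl)).of_eq rfl ?_ ?_
    · simp
    · have hu : update ρ f 0 = ρ := update_eq_self_iff.2 (hf f le_rfl).symm
      simp [print, hu, List.range_eq_range']
    · have := Nat.mul_le_mul_right (p.timeBound.eval (B + e.valueBound.eval B) + 2) hv
      simpa [timeBound, eval_comp] using this

end Printer

/-! ### Reading the input and clearing the registers -/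

namespace Prog

variable {w o : List Bool} {ρ : ℕ → ℕ}

/-- Remove a number in unary from the array and add it to the variable `k`. -/
def readUnary (k : ℕ) : Prog :=
  .seq (.while 0 (fun y => y == some true) (.seq (.pop 0) (inc k))) (.pop 0)

theorem runs_readUnary (k m : ℕ) :
    (readUnary k).Runs (store (unaryCode m ++ w) [] o ρ) (store w [] o (update ρ k (ρ k + m)))
      (3 * m + 2) := by
  have h : ∀ (m : ℕ) (ρ : ℕ → ℕ),
      (Prog.while 0 (fun y => y == some true) (.seq (.pop 0) (inc k))).Runs
        (store (unaryCode m ++ w) [] o ρ) (store (false :: w) [] o (update ρ k (ρ k + m)))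
        (3 * m + 1) := by
    intro m
    induction m with
    | zero => intro ρ; exact (Runs.whileFalse rfl).of_eq rfl (by simp [unaryCode]) le_rfl
    | succ m ih =>
      intro ρ
      have h₀ : (Prog.pop 0).Runs (store (unaryCode (m + 1) ++ w) [] o ρ)
          (store (unaryCode m ++ w) [] o ρ) 1 :=
        (Runs.pop _ _).of_eq rfl (by rw [update_store_zero]; rfl) le_rfl
      refine (Runs.whileTrue rfl (h₀.seq (runs_inc k)) (ih _)).of_eq rfl ?_ (by omega)
      simp [add_assoc, add_comm 1]
  refine ((h m ρ).seq (Runs.pop _ _)).of_eq rfl ?_ le_rfl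
  rw [update_store_zero]
  rfl

theorem runs_clear (k : ℕ) :
    (loop k .skip).Runs (store w [] o ρ) (store w [] o (update ρ k 0)) (3 * ρ k + 1) := by
  have h := runs_loop (P := .skip) (k := k) (c := 1) (fun _ => w) (fun _ => [])
    (fun _ => o) (fun j => update ρ k j) (by intro j; simp)
    (ρ k) (fun j _ => (Runs.skip _).of_eq rfl (by simp) le_rfl)
  exact h.of_eq (by simp) rfl (by omega)

theorem runs_clearArray : ∀ w : List Bool,
    (Prog.while 0 (fun y => y.isSome) (.pop 0)).Runs (store w [] o ρ) (store [] [] o ρ)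
      (2 * w.length + 1)
  | [] => Runs.whileFalse rfl
  | y :: w => by
    have h₀ : (Prog.pop 0).Runs (store (y :: w) [] o ρ) (store w [] o ρ) 1 :=
      (Runs.pop _ _).of_eq rfl (by rw [update_store_zero]; rfl) le_rfl
    refine (Runs.whileTrue rfl h₀ (runs_clearArray w)).mono ?_
    simp
    omega

end Prog

/-- The environment in which the first three variables have the given values. -/
def initialEnv (x y z : ℕ) : ℕ → ℕ := update (update (update (fun _ => 0) 0 x) 1 y) 2 z

/-- A map is computable in polynomial time if its inputs are encoded by three numbers in unary
and an array of bits, and a printer produces its outputs from them. -/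
theorem Printer.nonempty_polyTime {α β : Type} {ea : α → List Bool} {eb : β → List Bool}
    {f : α → β} {p : Printer} (hp : p.Closed 3) (x y z : α → ℕ) (w : α → List Bool)
    (hea : ∀ a, ea a = unaryCode (x a) ++ unaryCode (y a) ++ unaryCode (z a) ++ w a)
    (heb : ∀ a, eb (f a) = p.print (w a) 3 (initialEnv (x a) (y a) (z a))) :
    Nonempty (Turing.TM2ComputableInPolyTime ea eb f) := by
  refine Prog.nonempty_polyTime ea eb f
    (.seq (readUnary 0) (.seq (readUnary 1) (.seq (readUnary 2) (.seq (p.compile 3)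
      -- All stacks except the output must be empty at the end. Reading and clearing are linear in
      -- the input length, with ample constants in the bound.
      (.seq (loop 0 .skip) (.seq (loop 1 .skip) (.seq (loop 2 .skip)
        (.while 0 (fun y => y.isSome) (.pop 0)))))))))
    0 2 (p.timeBound + 20 * X + 10) fun a => ?_
  have hlen : (ea a).length = x a + y a + z a + 3 + (w a).length := by
    simp [hea, unaryCode]
    omega
  set ρ := initialEnv (x a) (y a) (z a) with hρ
  have hρ' : ∀ k, ρ k = if k = 2 then z a else if k = 1 then y a else if k = 0 then x a else 0 := by
    intro k
    simp only [hρ, initialEnv, update_apply]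
  have h₁ := runs_readUnary (w := unaryCode (y a) ++ (unaryCode (z a) ++ w a)) (o := [])
    (ρ := fun _ => 0) 0 (x a)
  have h₂ := runs_readUnary (w := unaryCode (z a) ++ w a) (o := [])
    (ρ := update (fun _ => 0) 0 (x a)) 1 (y a)
  have h₃ := runs_readUnary (w := w a) (o := [])
    (ρ := update (update (fun _ => 0) 0 (x a)) 1 (y a)) 2 (z a)
  -- The three numbers are given in unary, so the input length bounds them.
  have h₄ := p.runs_compile (w a) (o := []) (B := (ea a).length) (ρ := ρ) hp
    (fun k _ => by rw [hρ']; split_ifs <;> omega)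
    (fun k hk => by rw [hρ']; split_ifs <;> omega)
  rw [← heb, List.append_nil] at h₄
  have h₅ := runs_clear (w := w a) (o := eb (f a)) (ρ := ρ) 0
  have h₆ := runs_clear (w := w a) (o := eb (f a)) (ρ := update ρ 0 0) 1
  have h₇ := runs_clear (w := w a) (o := eb (f a)) (ρ := update (update ρ 0 0) 1 0) 2
  have h₈ := runs_clearArray (o := eb (f a)) (ρ := update (update (update ρ 0 0) 1 0) 2 0) (w a)
  refine ((h₁.of_eq rfl (by simp) le_rfl).seq ((h₂.of_eq rfl (by simp) le_rfl).seq
    ((h₃.of_eq rfl ?_ le_rfl).seq (h₄.seq (h₅.seq (h₆.seq (h₇.seq h₈))))))).of_eq ?_ ?_ ?_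
  · simp [hρ, initialEnv]
  · funext i
    rcases i with _ | _ | _ | i <;> simp [store, hea]
  · funext i
    rcases i with _ | _ | _ | i <;> simp [store]
    simp only [update_apply, hρ']
    split_ifs <;> rfl
  · have e₀ : ρ 0 = x a := by simp [hρ']
    have e₁ : update ρ 0 0 1 = y a := by simp [hρ']
    have e₂ : update (update ρ 0 0) 1 0 2 = z a := by simp [hρ']
    rw [e₀, e₁, e₂]
    simp only [eval_add, eval_mul, eval_X, eval_ofNat]
    omega

/-! ### Acyclic digraphs -/

namespace Digraph

variable {V : Type} {G : Digraph V}

theorem isDAG_of_rank (τ : V → ℕ) (h : ∀ u v, G.Adj u v → τ u < τ v) : G.IsDAG := by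
  have h' : ∀ u v, Relation.TransGen G.Adj u v → τ u < τ v := by
    intro u v huv
    induction huv with
    | single h₁ => exact h _ _ h₁
    | tail _ h₁ ih => exact ih.trans (h _ _ h₁)
  exact fun v hv => lt_irrefl _ (h' v v hv)

theorem IsDAG.nodup (hG : G.IsDAG) {l : List V} (hl : l.IsChain G.Adj) : l.Nodup := by
  have h : l.IsChain (Relation.TransGen G.Adj) := hl.imp fun _ _ => Relation.TransGen.single
  refine h.pairwise.imp ?_
  rintro a b hab rfl
  exact hG a hab

theorem transGen_of_leadsTo {u v : V} (h : G.LeadsTo u v) : Relation.TransGen G.Adj u v := by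
  obtain ⟨hne, p, hu, hv, hc, -⟩ := h
  obtain ⟨q, rfl⟩ : ∃ q, p = u :: q := by
    cases p with
    | nil => simp at hu
    | cons a q => exact ⟨q, by simpa using hu⟩
  have hc' : (u :: q).IsChain (Relation.TransGen G.Adj) :=
    hc.imp fun _ _ => Relation.TransGen.single
  have hv' : v ∈ u :: q := List.mem_of_getLast? hv
  rcases List.mem_cons.1 hv' with rfl | hv'
  · exact absurd rfl hne
  · exact (List.pairwise_cons.1 hc'.pairwise).1 v hv'

/-- In an acyclic digraph, a reachability-compatible order directs all arcs forward. -/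
theorem IsDAG.lt_of_adj (hG : G.IsDAG) {lt : V → V → Prop} (hlt : G.ReachCompatible lt) {u v : V}
    (h : G.Adj u v) : lt u v := by
  have hne : u ≠ v := by
    rintro rfl
    exact hG u (.single h)
  refine hlt.compat u v ⟨hne, [u, v], rfl, rfl, by simpa using h, by simpa using hne⟩ fun h' => ?_
  exact hG u ((Relation.TransGen.single h).trans (transGen_of_leadsTo h'))

/-- The directed distances from a vertex of an acyclic digraph are certified by a function that
increases by at most one along every arc, and by exactly one along some arc into every vertex
except for those of value `0`. -/
theorem IsDAG.diDist_eq (hG : G.IsDAG) {s : V} {D : V → ℕ} (h₀ : ∀ v, D v = 0 ↔ v = s)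
    (h₁ : ∀ u v, G.Adj u v → D v ≤ D u + 1)
    (h₂ : ∀ v, D v ≠ 0 → ∃ u, G.Adj u v ∧ D v = D u + 1) (v : V) : G.diDist s v = D v := by
  apply le_antisymm
  · have : ∀ d v, D v = d → ∃ p : List V, p.head? = some s ∧ p.getLast? = some v ∧
        p.IsChain G.Adj ∧ p.length = d + 1 := by
      intro d
      induction d with
      | zero =>
        intro v hv
        exact ⟨[s], rfl, by simp [(h₀ v).1 hv], by simp, rfl⟩
      | succ d ih =>
        intro v hv
        obtain ⟨u, huv, hu⟩ := h₂ v (by omega)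
        obtain ⟨p, hp₁, hp₂, hp₃, hp₄⟩ := ih u (by omega)
        refine ⟨p ++ [v], ?_, by simp, ?_, by simp [hp₄]⟩
        · rw [List.head?_append_of_ne_nil _ (by rintro rfl; simp at hp₁), hp₁]
        · refine hp₃.append (by simp) ?_
          simpa [hp₂] using huv
    obtain ⟨p, hp₁, hp₂, hp₃, hp₄⟩ := this _ v rfl
    exact iInf₂_le (D v) ⟨p, ⟨hp₁, hp₂, hp₃, hG.nodup hp₃⟩, hp₄⟩
  · have : ∀ (p : List V) (u : V), p.head? = some u → p.getLast? = some v → p.IsChain G.Adj →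
        D v + 1 ≤ D u + p.length := by
      intro p
      induction p with
      | nil => intro u hu; simp at hu
      | cons a p ih =>
        intro u hu hv hc
        obtain rfl : a = u := by simpa using hu
        cases p with
        | nil =>
          obtain rfl : a = v := by simpa using hv
          simp
        | cons b p =>
          rw [List.isChain_cons_cons] at hc
          have := ih b rfl (by simpa using hv) hc.2
          have := h₁ a b hc.1
          simp only [List.length_cons] at *
          omega
    refine le_iInf₂ ?_
    rintro k ⟨p, ⟨hp₁, hp₂, hp₃, -⟩, hp₄⟩
    have := this p s hp₁ hp₂ hp₃
    rw [(h₀ s).2 rfl] at this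
    exact_mod_cast (by omega : D v ≤ k)

end Digraph

/-! ### The normalized instance -/

namespace PAFP

variable {n : ℕ} (I : PAFP (Fin n))

theorem card_pos (I : PAFP (Fin n)) : 0 < n := (Nat.zero_le _).trans_lt I.s.2

/-- The vertex of which `i` is a copy, if `i < n * n`. -/
def col (I : PAFP (Fin n)) (i : ℕ) : Fin n := ⟨i % n, Nat.mod_lt _ I.card_pos⟩

/-- The arcs of the normalized digraph. Its vertices are, in this order, the copies of the original
vertices, arranged in `n` layers, then for every copy a guard, and finally a chain with twice as
many vertices as there are copies. The first vertex of the chain is the source. Arcs between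
copies descend through the layers. -/
def NormAdj (i j : ℕ) : Prop :=
  i < n * n ∧ j < n * n ∧ j / n < i / n ∧
    (I.G.Adj (I.col i) (I.col j) ∨ s(I.col i, I.col j) ∈ I.F) ∨
  j < n * n ∧ i = j + n * n ∨
  n * n ≤ j ∧ j < 2 * (n * n) ∧ i = 2 * j ∨
  2 * (n * n) ≤ i ∧ j = i + 1 ∨
  i + 1 = 4 * (n * n) ∧ j < n * n ∧ I.col j = I.s

/-- The forbidden pairs of the normalized instance. -/
def NormForb (i j : ℕ) : Prop :=
  i < n * n ∧ j < n * n ∧ i / n ≠ j / n ∧ s(I.col i, I.col j) ∈ I.F ∨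
  j < n * n ∧ i = j + n * n ∨
  i < n * n ∧ j = i + n * n

theorem NormForb.symm {i j : ℕ} (h : I.NormForb i j) : I.NormForb j i := by
  rcases h with ⟨h₁, h₂, h₃, h₄⟩ | h | h
  · exact Or.inl ⟨h₂, h₁, h₃.symm, Sym2.eq_swap ▸ h₄⟩
  · exact Or.inr (Or.inr h)
  · exact Or.inr (Or.inl h)

/-- This is why forbidden pairs also induce descending arcs, and why pairs within one layer, which
no path through the copies can contain, are not forbidden. -/
theorem normAdj_or_normAdj {i j : ℕ} (h : I.NormForb i j) : I.NormAdj i j ∨ I.NormAdj j i := by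
  rcases h with ⟨h₁, h₂, h₃, h₄⟩ | h | h
  · rcases lt_or_gt_of_ne h₃ with h₃ | h₃
    · exact Or.inr (Or.inl ⟨h₂, h₁, h₃, Or.inr (Sym2.eq_swap ▸ h₄)⟩)
    · exact Or.inl (Or.inl ⟨h₁, h₂, h₃, Or.inr h₄⟩)
  · exact Or.inl (Or.inr (Or.inl h))
  · exact Or.inr (Or.inr (Or.inl h))

/-- A topological ranking of the normalized digraph. -/
def normRank (n i : ℕ) : ℕ :=
  if i < n * n then 4 * (n * n) - i else if i < 2 * (n * n) then 2 * (n * n) else i - 2 * (n * n)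

/-- The distances from the source of the normalized digraph. -/
def normDist (n i : ℕ) : ℕ :=
  if i < n * n then 2 * i + 2 else if i < 2 * (n * n) then 2 * (i - n * n) + 1 else i - 2 * (n * n)

theorem lt_of_div_lt_div {i j k : ℕ} (h : i / k < j / k) : i < j := by
  by_contra h'
  exact absurd (Nat.div_le_div_right (c := k) (not_lt.1 h')) (not_le.2 h)

theorem normRank_lt {i j : ℕ} (hj : j < 4 * (n * n)) (h : I.NormAdj i j) :
    normRank n i < normRank n j := by
  unfold normRank
  rcases h with ⟨h₁, h₂, h₃, -⟩ | h | h | h | ⟨h₁, h₂, -⟩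
  · have := lt_of_div_lt_div h₃
    split_ifs; omega
  all_goals split_ifs <;> omega

/-- Descending arcs lower the number of a copy and hence its distance. The end of the chain has
distance `2 * (n * n) - 1` and no copy exceeds `2 * (n * n)`, so the chain is just long enough. -/
theorem normDist_le {i j : ℕ} (h : I.NormAdj i j) : normDist n j ≤ normDist n i + 1 := by
  unfold normDist
  rcases h with ⟨h₁, h₂, h₃, -⟩ | h | h | h | ⟨h₁, h₂, -⟩
  · have := lt_of_div_lt_div h₃
    split_ifs; omega
  all_goals split_ifs <;> omega

/-- The normalized instance. -/
def normalize : PAFP (Fin (4 * (n * n))) where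
  G := ⟨fun i j => I.NormAdj i j⟩
  loopless := fun i h => lt_irrefl _ (I.normRank_lt i.2 h)
  s := ⟨2 * (n * n), by have := I.card_pos; have := Nat.mul_pos this this; omega⟩
  -- Copies in layer `0` keep the original numbers, so the target is unchanged.
  t := ⟨I.t, by have := I.t.2; have := Nat.le_mul_self n; omega⟩
  s_ne_t := by
    have := I.t.2
    have := Nat.le_mul_self n
    simp only [ne_eq, Fin.mk.injEq]
    omega
  F := Sym2.fromRel (r := fun i j : Fin (4 * (n * n)) => I.NormForb i j) ⟨fun _ _ => NormForb.symm I⟩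
  F_pairs := by
    intro e
    induction e using Sym2.ind with
    | _ i j =>
      rw [Sym2.fromRel_prop, Sym2.mk_isDiag_iff]
      rintro h rfl
      rcases I.normAdj_or_normAdj h with h | h <;> exact lt_irrefl _ (I.normRank_lt i.2 h)

theorem mem_normalize_F {i j : Fin (4 * (n * n))} :
    s(i, j) ∈ I.normalize.F ↔ I.NormForb i j :=
  Sym2.fromRel_prop (sym := ⟨fun _ _ => NormForb.symm I⟩)

theorem normalize_isDAG : I.normalize.G.IsDAG :=
  Digraph.isDAG_of_rank (fun i => normRank n i) fun _ j h => I.normRank_lt j.2 h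

theorem unionDigraph_normalize {lt : Fin (4 * (n * n)) → Fin (4 * (n * n)) → Prop}
    (hlt : I.normalize.G.ReachCompatible lt) : I.normalize.unionDigraph lt = I.normalize.G := by
  ext i j
  refine ⟨?_, Or.inl⟩
  rintro (h | ⟨h, hij⟩)
  · exact h
  · rcases I.normAdj_or_normAdj (I.mem_normalize_F.1 h) with h | h
    · exact h
    · have := hlt.strictTotal
      exact absurd (I.normalize_isDAG.lt_of_adj hlt h) (asymm_of lt hij)

theorem diDist_normalize (i : Fin (4 * (n * n))) :
    I.normalize.G.diDist I.normalize.s i = normDist n i := by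
  have hn := Nat.mul_pos I.card_pos I.card_pos
  refine I.normalize_isDAG.diDist_eq (D := fun i => normDist n i) (fun i => ?_)
    (fun i j h => I.normDist_le h) (fun i hi => ?_) i
  · rw [Fin.ext_iff]
    change normDist n i = 0 ↔ (i : ℕ) = 2 * (n * n)
    simp only [normDist]
    split_ifs <;> first | omega | (simp only [false_iff]; omega)
  · have hi' := i.2
    rcases lt_or_ge (i : ℕ) (n * n) with h | h
    · refine ⟨⟨i + n * n, by omega⟩, Or.inr (Or.inl ⟨h, rfl⟩), ?_⟩
      simp only [normDist]
      split_ifs <;> omega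
    rcases lt_or_ge (i : ℕ) (2 * (n * n)) with h' | h'
    · refine ⟨⟨2 * i, by omega⟩, Or.inr (Or.inr (Or.inl ⟨h, h', rfl⟩)), ?_⟩
      simp only [normDist]
      split_ifs <;> omega
    · have : (i : ℕ) ≠ 2 * (n * n) := by
        intro h''
        refine hi ?_
        simp only [normDist]
        split_ifs <;> omega
      refine ⟨⟨i - 1, by omega⟩, Or.inr (Or.inr (Or.inr (Or.inl ⟨?_, ?_⟩))), ?_⟩
      · simp only
        omega
      · simp only
        omega
      · simp only [normDist]
        split_ifs <;> omega

theorem bfsWidth_normalize : I.normalize.G.bfsWidth I.normalize.s ≤ 2 := by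
  refine iSup_le fun d => ?_
  rw [← Fin.val_injective.encard_image]
  -- The chain vertex at distance `d`, and a copy or a guard according to parity. For `d = 0` the
  -- second candidate is spurious, which is harmless for an inclusion.
  refine (Set.encard_le_encard (t := {2 * (n * n) + d,
    if d % 2 = 0 then (d - 2) / 2 else n * n + (d - 1) / 2}) ?_).trans ?_
  · rintro _ ⟨i, hi, rfl⟩
    have hi : normDist n i = d := by
      exact_mod_cast (I.diDist_normalize i).symm.trans hi
    have hi' := i.2
    simp only [normDist] at hi
    simp only [Set.mem_insert_iff, Set.mem_singleton_iff]
    split_ifs at * <;> omega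
  · refine (Set.encard_insert_le _ _).trans ?_
    rw [Set.encard_singleton]
    norm_num

/-! ### Equivalence of the instances -/

/-- Each vertex goes into the layer that counts the arcs still to come. The path thus ends in layer
`0`, and its starting layer depends on its length, which is why the chain leads to all copies of
`s`. -/
theorem exists_layered_path : ∀ (q : List (Fin n)) (u v : Fin n), q.head? = some u →
    q.getLast? = some v → q.IsChain I.G.Adj → q.length ≤ n →
    ∃ l : List (Fin (4 * (n * n))), (∃ h, l.head? = some h ∧ (h : ℕ) < n * n ∧
      (h : ℕ) / n + 1 = q.length ∧ I.col h = u) ∧ (∃ h, l.getLast? = some h ∧ (h : ℕ) = v) ∧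
      l.IsChain I.normalize.G.Adj ∧ ∀ i ∈ l, (i : ℕ) < n * n ∧ I.col i ∈ q := by
  intro q
  induction q with
  | nil => intro u v hu; simp at hu
  | cons a q ih =>
    intro u v hu hv hc hlen
    obtain rfl : a = u := by simpa using hu
    have hn := I.card_pos
    have hlt : q.length * n + a < n * n := by
      have h₁ := a.2
      have h₂ : (q.length + 1) * n ≤ n * n := Nat.mul_le_mul_right n (by simpa using hlen)
      rw [Nat.succ_mul] at h₂
      omega
    have hdiv : (q.length * n + a) / n = q.length := by
      rw [mul_comm, Nat.mul_add_div hn, Nat.div_eq_of_lt a.2, add_zero]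
    have hcol : I.col (q.length * n + a) = a := by
      apply Fin.ext
      simp [col, Nat.mod_eq_of_lt a.2]
    let h : Fin (4 * (n * n)) := ⟨q.length * n + a, by omega⟩
    cases q with
    | nil =>
      obtain rfl : a = v := by simpa using hv
      refine ⟨[h], ⟨h, rfl, hlt, ?_, hcol⟩, ⟨h, rfl, by simp [h]⟩, by simp, ?_⟩
      · exact congrArg (· + 1) hdiv
      · simpa using ⟨hlt, hcol⟩
    | cons b q =>
      rw [List.isChain_cons_cons] at hc
      obtain ⟨l, ⟨h', hh', h₁, h₂, h₃⟩, ⟨e, he, he'⟩, hl, hm⟩ :=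
        ih b v rfl (by simpa using hv) hc.2 (by simp at hlen ⊢; omega)
      obtain ⟨l', rfl⟩ : ∃ l', l = h' :: l' := by
        cases l with
        | nil => simp at hh'
        | cons x l' => exact ⟨l', by simpa using hh'⟩
      refine ⟨h :: h' :: l', ⟨h, rfl, hlt, ?_, hcol⟩, ⟨e, by simpa using he, he'⟩, ?_, ?_⟩
      · exact congrArg (· + 1) hdiv
      · rw [List.isChain_cons_cons]
        refine ⟨Or.inl ⟨hlt, h₁, ?_, Or.inl ?_⟩, hl⟩
        · change (h' : ℕ) / n < ((b :: q).length * n + a) / n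
          rw [hdiv]
          omega
        · change I.G.Adj (I.col ((b :: q).length * n + a)) (I.col h')
          rw [hcol, h₃]
          exact hc.1
      · intro i hi
        rcases List.mem_cons.1 hi with rfl | hi
        · exact ⟨hlt, by change I.col ((b :: q).length * n + a) ∈ _; rw [hcol]; simp⟩
        · exact ⟨(hm i hi).1, List.mem_cons_of_mem _ (hm i hi).2⟩

/-- The chain is prepended from its end backwards, `k + 1` vertices of it; `k = 2 * (n * n) - 1`
reaches the source. No guard is visited. -/
theorem exists_chain_append {l : List (Fin (4 * (n * n)))} {h : Fin (4 * (n * n))}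
    (hl : l.head? = some h) (hh : (h : ℕ) < n * n) (hs : I.col h = I.s)
    (hc : l.IsChain I.normalize.G.Adj) : ∀ k < 2 * (n * n), ∃ c : List (Fin (4 * (n * n))),
      (∃ i, (c ++ l).head? = some i ∧ (i : ℕ) + k + 1 = 4 * (n * n)) ∧
      (c ++ l).IsChain I.normalize.G.Adj ∧ ∀ i ∈ c, 2 * (n * n) ≤ (i : ℕ) := by
  obtain ⟨l', rfl⟩ : ∃ l', l = h :: l' := by
    cases l with
    | nil => simp at hl
    | cons x l' => exact ⟨l', by simpa using hl⟩
  intro k hk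
  induction k with
  | zero =>
    refine ⟨[⟨4 * (n * n) - 1, by omega⟩], ⟨_, rfl, by simp only; omega⟩, ?_, ?_⟩
    · refine List.isChain_cons_cons.2 ⟨?_, hc⟩
      refine Or.inr (Or.inr (Or.inr (Or.inr ⟨?_, hh, hs⟩)))
      simp only
      omega
    · simp only [List.mem_singleton, forall_eq]
      omega
  | succ k ih =>
    obtain ⟨c, ⟨i, hi, hik⟩, hc', hm⟩ := ih (by omega)
    let j : Fin (4 * (n * n)) := ⟨i - 1, by omega⟩
    have hj : (j : ℕ) = i - 1 := rfl
    refine ⟨j :: c, ⟨j, rfl, by omega⟩, ?_, ?_⟩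
    · obtain ⟨y, hy⟩ : ∃ y, c ++ h :: l' = i :: y := by
        cases hcl : c ++ h :: l' with
        | nil => simp at hcl
        | cons x y => exact ⟨y, by rw [hcl] at hi; simpa using hi⟩
      rw [List.cons_append, hy, List.isChain_cons_cons, ← hy]
      exact ⟨Or.inr (Or.inr (Or.inr (Or.inl ⟨by omega, by omega⟩))), hc'⟩
    · intro x hx
      rcases List.mem_cons.1 hx with rfl | hx
      · omega
      · exact hm x hx

theorem isYes_normalize (h : I.IsYes) : I.normalize.IsYes := by
  obtain ⟨q, ⟨hu, hv, hc, hnd⟩, hsafe⟩ := h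
  have hlen : q.length ≤ n := by simpa using hnd.length_le_card
  obtain ⟨l, ⟨h, hh, h₁, -, h₂⟩, ⟨e, he, he'⟩, hl, hm⟩ :=
    I.exists_layered_path q _ _ hu hv hc hlen
  have hn := Nat.mul_pos I.card_pos I.card_pos
  obtain ⟨c, ⟨i, hi, hi'⟩, hcl, hcm⟩ :=
    I.exists_chain_append hh h₁ h₂ hl (2 * (n * n) - 1) (by omega)
  have hmem : ∀ x ∈ c ++ l, 2 * (n * n) ≤ (x : ℕ) ∨ (x : ℕ) < n * n ∧ I.col x ∈ q := by
    intro x hx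
    rcases List.mem_append.1 hx with hx | hx
    · exact Or.inl (hcm x hx)
    · exact Or.inr (hm x hx)
  refine ⟨c ++ l, ⟨?_, ?_, hcl, I.normalize_isDAG.nodup hcl⟩, ?_⟩
  · rw [hi]
    congr 1
    apply Fin.ext
    simp only [normalize]
    omega
  · rw [List.getLast?_append_of_ne_nil _ (by rintro rfl; simp at hh), he]
    congr 1
    exact Fin.ext he'
  · rintro x y hxy ⟨hx, hy⟩
    have hx' := hmem x hx
    have hy' := hmem y hy
    rcases I.mem_normalize_F.1 hxy with ⟨h₁, h₂, -, h₄⟩ | h | h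
    · exact hsafe _ _ h₄ ⟨(hx'.resolve_left (by omega)).2, (hy'.resolve_left (by omega)).2⟩
    · omega
    · omega

/-- From a copy, arcs lead only to copies in lower layers, and an arc that stems from a forbidden
pair has both its ends in a new forbidden pair. -/
theorem isChain_col : ∀ {l : List (Fin (4 * (n * n)))}, l.IsChain I.normalize.G.Adj →
    (∀ h, l.head? = some h → (h : ℕ) < n * n) → (∀ i ∈ l, ∀ j ∈ l, ¬ I.NormForb i j) →
    (∀ i ∈ l, (i : ℕ) < n * n) ∧ (l.map fun i : Fin (4 * (n * n)) => I.col i).IsChain I.G.Adj ∧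
      l.IsChain fun i j : Fin (4 * (n * n)) => (j : ℕ) / n < (i : ℕ) / n
  | [], _, _, _ => by simp
  | [a], _, hh, _ => by simpa using hh
  | a :: b :: l, hc, hh, hs => by
    rw [List.isChain_cons_cons] at hc
    have ha : (a : ℕ) < n * n := hh a rfl
    obtain ⟨hb, hlay, hadj⟩ : (b : ℕ) < n * n ∧ (b : ℕ) / n < (a : ℕ) / n ∧
        I.G.Adj (I.col a) (I.col b) := by
      rcases hc.1 with ⟨_, h₂, h₃, h₄ | h₄⟩ | h | h | h | h
      · exact ⟨h₂, h₃, h₄⟩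
      · exact absurd (Or.inl ⟨ha, h₂, h₃.ne', h₄⟩) (hs a (by simp) b (by simp))
      all_goals omega
    obtain ⟨h₁, h₂, h₃⟩ := isChain_col hc.2 (by simpa using hb)
      fun i hi j hj => hs i (List.mem_cons_of_mem _ hi) j (List.mem_cons_of_mem _ hj)
    refine ⟨?_, ?_, ?_⟩
    · intro i hi
      rcases List.mem_cons.1 hi with rfl | hi
      · exact ha
      · exact h₁ i hi
    · exact List.isChain_cons_cons.2 ⟨hadj, h₂⟩
    · exact List.isChain_cons_cons.2 ⟨hlay, h₃⟩

/-- To reach a copy from outside, a path must leave a guard, which is forbidden together with its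
copy, or leave the end of the chain, which leads to a copy of `s`. -/
theorem exists_suffix : ∀ {l : List (Fin (4 * (n * n)))}, l.IsChain I.normalize.G.Adj →
    (∃ h, l.head? = some h ∧ n * n ≤ (h : ℕ)) → (∃ h, l.getLast? = some h ∧ (h : ℕ) < n * n) →
    (∀ i ∈ l, ∀ j ∈ l, ¬ I.NormForb i j) →
    ∃ l', l' <:+ l ∧ ∃ h, l'.head? = some h ∧ (h : ℕ) < n * n ∧ I.col h = I.s
  | [], _, hh, _, _ => by simp at hh
  | [a], _, ⟨h, hh, h₁⟩, ⟨e, he, h₂⟩, _ => by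
    simp only [List.head?_cons, List.getLast?_singleton, Option.some.injEq] at hh he
    subst hh he
    omega
  | a :: b :: l, hc, ⟨h, hh, h₁⟩, he, hs => by
    obtain rfl : a = h := by simpa using hh
    rw [List.isChain_cons_cons] at hc
    have h_rec : n * n ≤ (b : ℕ) →
        ∃ l', l' <:+ a :: b :: l ∧ ∃ h, l'.head? = some h ∧ (h : ℕ) < n * n ∧ I.col h = I.s := by
      intro hb
      obtain ⟨l', h₁, h₂⟩ := exists_suffix hc.2 ⟨b, rfl, hb⟩ (by simpa using he)
        fun i hi j hj => hs i (List.mem_cons_of_mem _ hi) j (List.mem_cons_of_mem _ hj)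
      exact ⟨l', h₁.trans (List.suffix_cons _ _), h₂⟩
    rcases hc.1 with h | h | h | h | h
    · omega
    · exact absurd (Or.inr (Or.inl h)) (hs a (by simp) b (by simp))
    · exact h_rec h.1
    · exact h_rec (by omega)
    · exact ⟨b :: l, List.suffix_cons _ _, b, rfl, h.2⟩

theorem isYes_of_isYes_normalize (hG : I.G.IsDAG) (h : I.normalize.IsYes) : I.IsYes := by
  obtain ⟨p, ⟨hu, hv, hc, -⟩, hsafe⟩ := h
  have hs : ∀ i ∈ p, ∀ j ∈ p, ¬ I.NormForb i j :=
    fun i hi j hj hij => hsafe i j (I.mem_normalize_F.2 hij) ⟨hi, hj⟩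
  have ht : (I.t : ℕ) < n * n := I.t.2.trans_le (Nat.le_mul_self n)
  obtain ⟨l, hl, h, hh, h₁, h₂⟩ := I.exists_suffix hc
    ⟨_, hu, by simp only [normalize]; omega⟩ ⟨_, hv, ht⟩ hs
  have hls : ∀ i ∈ l, ∀ j ∈ l, ¬ I.NormForb i j :=
    fun i hi j hj => hs i (hl.subset hi) j (hl.subset hj)
  obtain ⟨h₃, h₄, h₅⟩ := I.isChain_col (hc.suffix hl) (by simpa [hh] using h₁) hls
  have hlast : l.getLast? = some I.normalize.t := by
    obtain ⟨c, rfl⟩ := hl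
    rwa [List.getLast?_append_of_ne_nil _ (by rintro rfl; simp at hh)] at hv
  refine ⟨l.map fun i : Fin (4 * (n * n)) => I.col i, ⟨?_, ?_, h₄, hG.nodup h₄⟩, ?_⟩
  · simp [hh, h₂]
  · rw [List.getLast?_map, hlast]
    simp [normalize, col, Nat.mod_eq_of_lt I.t.2]
  · rintro u v huv ⟨hu', hv'⟩
    obtain ⟨i, hi, rfl⟩ := List.mem_map.1 hu'
    obtain ⟨j, hj, rfl⟩ := List.mem_map.1 hv'
    have : Trans (fun i j : Fin (4 * (n * n)) => (j : ℕ) / n < (i : ℕ) / n)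
        (fun i j : Fin (4 * (n * n)) => (j : ℕ) / n < (i : ℕ) / n)
        (fun i j : Fin (4 * (n * n)) => (j : ℕ) / n < (i : ℕ) / n) :=
      ⟨fun h₁ h₂ => lt_trans h₂ h₁⟩
    have : Std.Symm fun i j : Fin (4 * (n * n)) => (i : ℕ) / n ≠ (j : ℕ) / n :=
      ⟨fun _ _ => Ne.symm⟩
    have hlay : l.Pairwise fun i j : Fin (4 * (n * n)) => (i : ℕ) / n ≠ (j : ℕ) / n :=
      h₅.pairwise.imp fun h => ne_of_gt h
    -- The ends of a forbidden pair differ, so their copies are distinct vertices of the descending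
    -- path and lie in different layers.
    refine hls i hi j hj (Or.inl ⟨h₃ i hi, h₃ j hj, hlay.forall hi hj ?_, huv⟩)
    rintro rfl
    exact I.F_pairs _ huv rfl

end PAFP

/-! ### The printer of the normalized instance -/

namespace Expr

/-- `lt a b` is non-zero if and only if `a < b`. -/
def lt (a b : Expr) : Expr := sub b a

/-- `le a b` is non-zero if and only if `a ≤ b`. -/
def le (a b : Expr) : Expr := sub (add b (const 1)) a

/-- `eq a b` is non-zero if and only if `a = b`. -/
def eq (a b : Expr) : Expr := sub (const 1) (add (sub a b) (sub b a))

/-- `ne a b` is non-zero if and only if `a ≠ b`. -/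
def ne (a b : Expr) : Expr := add (sub a b) (sub b a)

variable {w : List Bool} {ρ : ℕ → ℕ} {a b : Expr}

theorem eval_lt_ne_zero : (lt a b).eval w ρ ≠ 0 ↔ a.eval w ρ < b.eval w ρ := by
  simp only [lt, eval]
  omega

theorem eval_le_ne_zero : (le a b).eval w ρ ≠ 0 ↔ a.eval w ρ ≤ b.eval w ρ := by
  simp only [le, eval]
  omega

theorem eval_eq_ne_zero : (eq a b).eval w ρ ≠ 0 ↔ a.eval w ρ = b.eval w ρ := by
  simp only [eq, eval]
  omega

theorem eval_ne_ne_zero : (ne a b).eval w ρ ≠ 0 ↔ a.eval w ρ ≠ b.eval w ρ := by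
  simp only [ne, eval]
  omega

theorem eval_mul_ne_zero : (mul a b).eval w ρ ≠ 0 ↔ a.eval w ρ ≠ 0 ∧ b.eval w ρ ≠ 0 := by
  simp [eval]

theorem eval_add_ne_zero : (add a b).eval w ρ ≠ 0 ↔ a.eval w ρ ≠ 0 ∨ b.eval w ρ ≠ 0 := by
  simp only [eval]
  omega

theorem eval_bit_ne_zero : (bit a).eval w ρ ≠ 0 ↔ w[a.eval w ρ]? = some true := by
  simp [eval]

end Expr

/-! ### Row-major matrices -/

theorem List.flatMap_range_mul {α : Type} (a b : ℕ) (g : ℕ → List α) :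
    (List.range (a * b)).flatMap g =
      (List.range a).flatMap fun i => (List.range b).flatMap fun j => g (i * b + j) := by
  induction a with
  | zero => simp
  | succ a ih =>
    rw [Nat.succ_mul, List.range_add, List.flatMap_append, ih, List.range_succ,
      List.flatMap_append, List.flatMap_map]
    simp

theorem Fin.mul_add_lt_sq {n : ℕ} (u v : Fin n) : (u * n + v : ℕ) < n * n := by
  have h := Nat.mul_le_mul_right n (Nat.succ_le_of_lt u.2)
  rw [Nat.succ_mul] at h
  have := v.2
  omega

open Classical in
theorem matrixCode_eq_ofFn {n : ℕ} (R : Fin n → Fin n → Prop) :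
    matrixCode R = List.ofFn fun k : Fin (n * n) => decide (R k.divNat k.modNat) := by
  rw [List.ofFn_mul, List.ofFn_eq_map, matrixCode, List.flatMap]
  congr 1
  refine List.map_congr_left fun i _ => ?_
  rw [List.ofFn_eq_map]
  refine List.map_congr_left fun j _ => ?_
  have hn : 0 < n := (Nat.zero_le _).trans_lt i.2
  have h₁ : ∀ h, (⟨i * n + j, h⟩ : Fin (n * n)).divNat = i := by
    intro h
    apply Fin.ext
    simp [Fin.divNat, mul_comm (i : ℕ) n, Nat.mul_add_div hn]
  have h₂ : ∀ h, (⟨i * n + j, h⟩ : Fin (n * n)).modNat = j := by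
    intro h
    apply Fin.ext
    simp [Fin.modNat, Nat.mod_eq_of_lt j.2]
  rw [h₁, h₂]

theorem length_matrixCode {n : ℕ} (R : Fin n → Fin n → Prop) : (matrixCode R).length = n * n := by
  rw [matrixCode_eq_ofFn, List.length_ofFn]

theorem matrixCode_getElem? {n : ℕ} (R : Fin n → Fin n → Prop) (u v : Fin n) :
    (matrixCode R)[(u * n + v : ℕ)]? = some true ↔ R u v := by
  have hn : 0 < n := (Nat.zero_le _).trans_lt u.2
  have hlt := u.mul_add_lt_sq v
  have h₁ : (⟨u * n + v, hlt⟩ : Fin (n * n)).divNat = u := by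
    apply Fin.ext
    simp [Fin.divNat, mul_comm (u : ℕ) n, Nat.mul_add_div hn]
  have h₂ : (⟨u * n + v, hlt⟩ : Fin (n * n)).modNat = v := by
    apply Fin.ext
    simp [Fin.modNat, Nat.mod_eq_of_lt v.2]
  rw [matrixCode_eq_ofFn, List.getElem?_ofFn, dif_pos hlt, h₁, h₂]
  simp

open Classical in
-- Expressions have no division. Splitting each index into `i * b + u` makes its quotient and
-- remainder, for copies the layer and the original vertex, available as loop variables.
theorem matrixCode_eq_flatMap {N a b : ℕ} (hN : N = a * b) (R : ℕ → ℕ → Prop) :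
    matrixCode (fun i j : Fin N => R i j) =
      (List.range a).flatMap fun i => (List.range b).flatMap fun u =>
        (List.range a).flatMap fun j => (List.range b).flatMap fun v =>
          [decide (R (i * b + u) (j * b + v))] := by
  have h : ∀ g : ℕ → List Bool, ((List.finRange N).flatMap fun i : Fin N => g i) =
      (List.range (a * b)).flatMap g := by
    intro g
    rw [← hN, ← List.map_coe_finRange_eq_range, List.flatMap_map]
  have h' : ∀ i : Fin N, ((List.finRange N).map fun j : Fin N => decide (R i j)) =
      (List.range (a * b)).flatMap fun j => [decide (R i j)] := by
    intro i
    rw [← h, List.map_eq_flatMap]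
  simp only [matrixCode, h']
  rw [h fun i => (List.range (a * b)).flatMap fun j => [decide (R i j)]]
  simp only [List.flatMap_range_mul]

namespace Printer

/-- Print the value of an expression in unary. -/
def unary (e : Expr) : Printer := .seq (.for e (.emit (.const 1))) (.emit (.const 0))

theorem print_unary (w : List Bool) (e : Expr) (f : ℕ) (ρ : ℕ → ℕ) :
    (unary e).print w f ρ = unaryCode (e.eval w ρ) := by
  have h : ∀ m : ℕ, ((List.range m).flatMap fun _ => [true]) = List.replicate m true := by
    intro m
    rw [← List.map_eq_flatMap]
    simp
  simp [unary, print, Expr.eval, unaryCode, h]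

/-- Print a matrix, whose rows and columns are indexed by `a * b + u` with `u < b`. The variables
of the entry are `f`, `f + 1` for the row and `f + 2`, `f + 3` for the column. -/
def matrix (a b e : Expr) : Printer := .for a (.for b (.for a (.for b (.emit e))))

end Printer

/-! ### The normalized matrices as arithmetic expressions -/

namespace PAFP

open Printer

/-- The number of vertices, as an expression. -/
def cardE : Expr := .var 0

/-- The square of the number of vertices, as an expression. -/
def sqE : Expr := .mul (.var 0) (.var 0)

/-- The row of a matrix entry, as an expression. -/
def rowE : Expr := .add (.mul (.var 3) (.var 0)) (.var 4)

/-- The column of a matrix entry, as an expression. -/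
def colE : Expr := .add (.mul (.var 5) (.var 0)) (.var 6)

/-- The position of an arc in the array, as an expression. -/
def posE : Expr := .add (.mul (.var 4) (.var 0)) (.var 6)

/-- The adjacency matrix of the normalized digraph, as an expression. -/
def adjE : Expr :=
  .add (.mul (.lt rowE sqE) (.mul (.lt colE sqE) (.mul (.lt (.var 5) (.var 3))
    (.add (.bit posE) (.bit (.add sqE posE))))))
  (.add (.mul (.lt colE sqE) (.eq rowE (.add colE sqE)))
  (.add (.mul (.le sqE colE) (.mul (.lt colE (.mul (.const 2) sqE))
    (.eq rowE (.mul (.const 2) colE))))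
  (.add (.mul (.le (.mul (.const 2) sqE) rowE) (.eq colE (.add rowE (.const 1))))
  (.mul (.eq (.add rowE (.const 1)) (.mul (.const 4) sqE)) (.mul (.lt colE sqE)
    (.eq (.var 6) (.var 1)))))))

/-- The matrix of the forbidden pairs of the normalized instance, as an expression. -/
def forbE : Expr :=
  .add (.mul (.lt rowE sqE) (.mul (.lt colE sqE) (.mul (.ne (.var 3) (.var 5))
    (.bit (.add sqE posE)))))
  (.add (.mul (.lt colE sqE) (.eq rowE (.add colE sqE)))
  (.mul (.lt rowE sqE) (.eq colE (.add rowE sqE))))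

/-- The printer of the normalized instance. -/
def normalizePrinter : Printer :=
  .seq (.seq (.seq (.seq (unary (.mul (.const 4) sqE)) (unary (.mul (.const 2) sqE)))
    (unary (.var 2))) (matrix (.mul (.const 4) cardE) cardE adjE))
    (matrix (.mul (.const 4) cardE) cardE forbE)

theorem normalizePrinter_closed : normalizePrinter.Closed 3 := by
  simp [normalizePrinter, Printer.Closed, unary, matrix, adjE, forbE, rowE, colE, posE, sqE, cardE,
    Expr.lt, Expr.le, Expr.eq, Expr.ne, Expr.Below]

variable {n : ℕ} (I : PAFP (Fin n))

/-- The array of the encoding of an instance. -/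
noncomputable def array : List Bool :=
  matrixCode I.G.Adj ++ matrixCode fun u v => s(u, v) ∈ I.F

theorem array_adj (u v : Fin n) :
    I.array[(u * n + v : ℕ)]? = some true ↔ I.G.Adj u v := by
  have hlt := u.mul_add_lt_sq v
  rw [array, List.getElem?_append_left (by rwa [length_matrixCode]), matrixCode_getElem?]

theorem array_forb (u v : Fin n) :
    I.array[(n * n + (u * n + v) : ℕ)]? = some true ↔ s(u, v) ∈ I.F := by
  rw [array, List.getElem?_append_right (by rw [length_matrixCode]; omega), length_matrixCode,
    Nat.add_sub_cancel_left, matrixCode_getElem?]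

/-- The values of the variables at a matrix entry. -/
def entryEnv (I : PAFP (Fin n)) (a u b v : ℕ) : ℕ → ℕ :=
  update (update (update (update (initialEnv n I.s I.t) 3 a) 4 u) 5 b) 6 v

variable {a u b v : ℕ}

theorem entryEnv_zero : I.entryEnv a u b v 0 = n := by simp [entryEnv, initialEnv]
theorem entryEnv_one : I.entryEnv a u b v 1 = I.s := by simp [entryEnv, initialEnv]
theorem entryEnv_three : I.entryEnv a u b v 3 = a := by simp [entryEnv]
theorem entryEnv_four : I.entryEnv a u b v 4 = u := by simp [entryEnv]
theorem entryEnv_five : I.entryEnv a u b v 5 = b := by simp [entryEnv]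
theorem entryEnv_six : I.entryEnv a u b v 6 = v := by simp [entryEnv]

theorem mul_add_div_eq (hu : u < n) : (a * n + u) / n = a := by
  rw [mul_comm, Nat.mul_add_div (by omega), Nat.div_eq_of_lt hu, add_zero]

theorem col_mul_add (hu : u < n) : I.col (a * n + u) = ⟨u, hu⟩ := by
  apply Fin.ext
  simp [col, Nat.mod_eq_of_lt hu]

/-- Products act as conjunctions and sums as disjunctions, so the expression mirrors `NormAdj`
clause by clause. -/
theorem eval_adjE (hu : u < n) (hv : v < n) :
    adjE.eval I.array (I.entryEnv a u b v) ≠ 0 ↔ I.NormAdj (a * n + u) (b * n + v) := by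
  simp only [adjE, eval_add_ne_zero, eval_mul_ne_zero, eval_lt_ne_zero, eval_le_ne_zero,
    eval_eq_ne_zero, eval_bit_ne_zero]
  simp only [rowE, colE, posE, sqE, Expr.eval, entryEnv_zero,
    entryEnv_one, entryEnv_three, entryEnv_four, entryEnv_five, entryEnv_six, NormAdj,
    mul_add_div_eq hu, mul_add_div_eq hv, col_mul_add I hu, col_mul_add I hv,
    I.array_adj ⟨u, hu⟩ ⟨v, hv⟩, I.array_forb ⟨u, hu⟩ ⟨v, hv⟩, Fin.ext_iff]

theorem eval_forbE (hu : u < n) (hv : v < n) :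
    forbE.eval I.array (I.entryEnv a u b v) ≠ 0 ↔ I.NormForb (a * n + u) (b * n + v) := by
  simp only [forbE, eval_add_ne_zero, eval_mul_ne_zero, eval_lt_ne_zero, eval_ne_ne_zero,
    eval_eq_ne_zero, eval_bit_ne_zero]
  simp only [rowE, colE, posE, sqE, Expr.eval, entryEnv_zero,
    entryEnv_three, entryEnv_four, entryEnv_five, entryEnv_six, NormForb,
    mul_add_div_eq hu, mul_add_div_eq hv, col_mul_add I hu, col_mul_add I hv,
    I.array_forb ⟨u, hu⟩ ⟨v, hv⟩]

theorem print_matrix {e : Expr} {R : ℕ → ℕ → Prop}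
    (h : ∀ a u b v, u < n → v < n →
      (e.eval I.array (I.entryEnv a u b v) ≠ 0 ↔ R (a * n + u) (b * n + v))) :
    (matrix (.mul (.const 4) cardE) cardE e).print I.array 3 (initialEnv n I.s I.t) =
      matrixCode fun i j : Fin (4 * (n * n)) => R i j := by
  rw [matrixCode_eq_flatMap (show 4 * (n * n) = (4 * n) * n by ring)]
  have h₀ : initialEnv n I.s I.t 0 = n := by simp [initialEnv]
  simp only [matrix, print, cardE, Expr.eval, h₀, ne_eq, not_false_eq_true,
    update_of_ne, OfNat.zero_ne_ofNat, Nat.reduceAdd]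
  refine List.flatMap_congr fun a _ => List.flatMap_congr fun u hu => List.flatMap_congr fun b _ =>
    List.flatMap_congr fun v hv => ?_
  congr 1
  rw [decide_eq_decide]
  exact h a u b v (List.mem_range.1 hu) (List.mem_range.1 hv)

end PAFP

theorem encode_normalize (I : PAFPInstance) :
    PAFPInstance.encode ⟨4 * (I.n * I.n), I.inst.normalize⟩ =
      PAFP.normalizePrinter.print I.inst.array 3 (initialEnv I.n I.inst.s I.inst.t) := by
  have hG := I.inst.print_matrix (R := I.inst.NormAdj) fun a u b v => I.inst.eval_adjE
  have hF := I.inst.print_matrix (R := I.inst.NormForb) fun a u b v => I.inst.eval_forbE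
  simp only [PAFP.normalizePrinter, Printer.print, hG, hF, Printer.print_unary,
    PAFPInstance.encode, PAFP.mem_normalize_F]
  simp [Expr.eval, PAFP.sqE, initialEnv, PAFP.normalize]

theorem theorem2 :
    ∃ Normalize : DAGInstance → PAFPInstance,
      Nonempty (Turing.TM2ComputableInPolyTime DAGInstance.encode PAFPInstance.encode Normalize) ∧
      ∀ I : DAGInstance,
        (Normalize I).inst.G.IsDAG ∧
        ((Normalize I).inst.t : ℕ) = (I.1.inst.t : ℕ) ∧
        I.1.n ≤ ((Normalize I).inst.s : ℕ) ∧
        (∀ rule : OrderRule,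
          ((Normalize I).inst.unionDigraph (rule.lt (Normalize I).inst.G)).bfsWidth
            (Normalize I).inst.s ≤ 2) ∧
        (I.1.inst.IsYes ↔ (Normalize I).inst.IsYes) := by
  refine ⟨fun I => ⟨4 * (I.1.n * I.1.n), I.1.inst.normalize⟩, ?_, fun I => ?_⟩
  · refine Printer.nonempty_polyTime PAFP.normalizePrinter_closed (fun I => I.1.n)
      (fun I => I.1.inst.s) (fun I => I.1.inst.t) (fun I => I.1.inst.array) (fun I => ?_)
      fun I => encode_normalize I.1
    simp [DAGInstance.encode, PAFPInstance.encode, PAFP.array]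
  · refine ⟨I.1.inst.normalize_isDAG, rfl, ?_, fun rule => ?_, I.1.inst.isYes_normalize,
      I.1.inst.isYes_of_isYes_normalize I.2⟩
    · have := Nat.le_mul_self I.1.n
      simp only [PAFP.normalize]
      omega
    · rw [PAFP.unionDigraph_normalize _ (rule.compatible _)]
      exact I.1.inst.bfsWidth_normalize
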